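/- For $n\ge 1$ and $p,s\in[0,1]$, let $\mathcal G(n,p;s)$ be the following law of $(G_1,G_2,\pi^*)$: $G_0$ is an Erdős–Rényi graph $\mathcal G(n,p)$ on $[n]$; given $G_0$, the graphs $G_1^*$ and $G_2$ are obtained from $G_0$ by two independent subsamplings, each keeping every edge independently with probability $s$; $\pi^*$ is a uniform permutation of $[n]$ independent of these graphs; and $G_1$ is $G_1^*$ with every vertex $i$ relabelled as $\pi^*(i)$. In the seeded model $\mathcal G(n,p;s,\alpha)$ one is also given $\pi_0:[n]\to[n]\cup\{?\}$ such that, independently for different $i$ and of everything else, $\pi_0(i)=\pi^*(i)$ with probability $\alpha$ and $\pi_0(i)={?}$ with probability $1-\alpha$. A seeded graph matching algorithm $\mathcal A$ is a (possibly randomized) map which to every input $(G_1,G_2,\pi_0)$, with arbitrary $\pi_0:[n]\to[n]\cup\{?\}$, assigns a permutation of $[n]$. "With high probability" means with probability tending to $1$ as $n\to\infty$. Given such an $\mathcal A$ and $\alpha\in[0,1]$, the seedless algorithm $\mathcal B$ does the following on input $(G_1,G_2)$. (1) It selects a random subset $I_0\subseteq[n]$ by including each vertex independently with probability $\alpha$.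 (2) For each of the mappings $f:I_0\to[n]$, it calls $\mathcal A$ once (with fresh randomness) on $(G_1,G_2,\pi_0)$, where $\pi_0=f$ on $I_0$ and $\pi_0={?}$ off $I_0$; let $\pi_f$ be the answer. (3) It outputs a permutation $\hat\pi\in\arg\min_{\pi_f}\|G_1-\Pi_fG_2\Pi_f^\top\|_F^2$, where the graphs are identified with their adjacency matrices, $\Pi_f$ is the permutation matrix with $(\Pi_f)_{\pi_f(i),i}=1$, and ties are broken by an arbitrary rule. Theorem. There is an absolute constant $C>0$ such that the following holds. Let $p=p_n$, $s=s_n$, $\alpha=\alpha_n$ be sequences in $[0,1]$ such that $s=\Theta(1)$, $p$ is bounded away from $1$ (that is, $p_n\le p_1$ for all large $n$, with some constant $p_1<1$), $$nps^2-\log n\to+\infty\quad\text{and}\quad \alpha n\to+\infty .$$ Suppose that a seeded graph matching algorithm $\mathcal A$ outputs $\pi^*$ with high probability under the seeded model $\mathcal G(n,p;s,\alpha)$. Then, under the seedless model $\mathcal G(n,p;s)$, with high probability the algorithm $\mathcal B$ outputs $\hat\pi=\pi^*$ and calls $\mathcal A$ at most $n^{C\alpha n}$ times. -/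

import Mathlib

open Filter Topology
open scoped unitInterval ENNReal

noncomputable section

namespace GraphMatching

/-! ## The random graph models -/

instance instMeasurableSingletonClassSimpleGraph (n : ℕ) :
    MeasurableSingletonClass (SimpleGraph (Fin n)) where
  measurableSet_singleton G := by
    have h : ({G} : Set (SimpleGraph (Fin n))) = SimpleGraph.edgeSet ⁻¹' {G.edgeSet} := by
      ext H
      simp
    rw [h]
    exact SimpleGraph.measurable_edgeSet (measurableSet_singleton _)

/-- Subsampling: keep every edge of `G` independently with probability `s`. -/
def subsample {n : ℕ} (s : I) (G : SimpleGraph (Fin n)) : PMF (SimpleGraph (Fin n)) :=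
  (ProbabilityTheory.setBernoulli G.edgeSet s).toPMF.map SimpleGraph.fromEdgeSet

/-- A random subset of `[n]` containing every element independently with probability `α`. -/
def randomSubset (n : ℕ) (α : I) : PMF (Set (Fin n)) :=
  (ProbabilityTheory.setBernoulli (Set.univ : Set (Fin n)) α).toPMF

/-- The joint law of `(G₁, G₂, π*)` under the correlated Erdős–Rényi model `𝒢(n, p; s)`:
`G₀ ∼ 𝒢(n, p)`; given `G₀`, the graphs `G₁*` and `G₂` are two independent subsamples of `G₀`;
`π*` is an independent uniform permutation; and `G₁` is `G₁*` with every vertex `i` relabelled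
as `π* i`. -/
def correlatedER (n : ℕ) (p s : I) :
    PMF (SimpleGraph (Fin n) × SimpleGraph (Fin n) × Equiv.Perm (Fin n)) :=
  (SimpleGraph.binomialRandom (Fin n) p).toPMF.bind fun G₀ =>
  (subsample s G₀).bind fun G₁' =>
  (subsample s G₀).bind fun G₂ =>
  (PMF.uniformOfFintype (Equiv.Perm (Fin n))).bind fun π =>
  PMF.pure (G₁'.map π, G₂, π)

/-- The input of a seeded graph matching algorithm: two graphs `G₁`, `G₂` and a seed map
`π₀ : [n] → [n] ∪ {?}`, where `none` stands for `?`. -/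
abbrev SeededInput (n : ℕ) : Type :=
  SimpleGraph (Fin n) × SimpleGraph (Fin n) × (Fin n → Option (Fin n))

open Classical in
/-- The seed map with seed set `S` and values `f` on `S`. -/
def seedMap {n : ℕ} (S : Set (Fin n)) (f : S → Fin n) : Fin n → Option (Fin n) :=
  fun i => if h : i ∈ S then some (f ⟨i, h⟩) else none

/-- The joint law of `((G₁, G₂, π₀), π*)` under the seeded model `𝒢(n, p; s, α)`: every vertex is
a seed, that is `π₀ i = π* i`, independently with probability `α`, and `π₀ i = ?` otherwise. -/
def seededModel (n : ℕ) (p s α : I) : PMF (SeededInput n × Equiv.Perm (Fin n)) :=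
  (correlatedER n p s).bind fun x =>
  (randomSubset n α).bind fun S =>
  PMF.pure ((x.1, x.2.1, seedMap S fun i => x.2.2 i), x.2.2)

/-- A (possibly randomized) seeded graph matching algorithm on `n` vertices: on each input, the
law of the permutation that it outputs. -/
abbrev SeededAlg (n : ℕ) : Type :=
  SeededInput n → PMF (Equiv.Perm (Fin n))

/-- The probability that the algorithm `A` outputs `π*` under the seeded model
`𝒢(n, p; s, α)`. -/
def seededSuccess (n : ℕ) (p s α : I) (A : SeededAlg n) : ℝ≥0∞ :=
  ((seededModel n p s α).bind fun x => (A x.1).map fun π => (π, x.2)).toOuterMeasure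
    {y | y.1 = y.2}

/-! ## Randomized programs that call a subroutine -/

/-- Randomized programs with results in `A` that may call a subroutine, which takes queries in `Q`
and answers in `R`. -/
inductive OracleProgram (Q R A : Type) : Type 1 where
  /-- stop with a result -/
  | ret (a : A) : OracleProgram Q R A
  /-- draw a random element with law `μ` and go on with it -/
  | sample {B : Type} (μ : PMF B) (k : B → OracleProgram Q R A) : OracleProgram Q R A
  /-- call the subroutine on `q` and go on with its answer -/
  | call (q : Q) (k : R → OracleProgram Q R A) : OracleProgram Q R A

/-- The joint law of the result and of the number of calls of the subroutine, when every call on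
`q` is answered, with fresh randomness, according to the law `O q`. -/
def OracleProgram.run {Q R A : Type} (O : Q → PMF R) : OracleProgram Q R A → PMF (A × ℕ)
  | .ret a => PMF.pure (a, 0)
  | .sample μ k => μ.bind fun b => (k b).run O
  | .call q k => (O q).bind fun r => ((k r).run O).map fun x => (x.1, x.2 + 1)

/-- Call the subroutine once on each query of the list, in order, and go on with the list of
answers. -/
def OracleProgram.callAll {Q R A : Type} :
    List Q → (List R → OracleProgram Q R A) → OracleProgram Q R A
  | [], k => k []
  | q :: qs, k => .call q fun r => callAll qs fun rs => k (r :: rs)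

/-! ## Seedless graph matching via seeded graph matching -/

open Classical in
/-- The adjacency matrix of a graph. -/
def adj {n : ℕ} (G : SimpleGraph (Fin n)) : Matrix (Fin n) (Fin n) ℝ :=
  G.adjMatrix ℝ

/-- The permutation matrix `Π` of `π`, with `Π (π i) i = 1`, so that
`(Π * G * Πᵀ) (π i) (π j) = G i j`. -/
def permMat {n : ℕ} (π : Equiv.Perm (Fin n)) : Matrix (Fin n) (Fin n) ℝ :=
  Matrix.of fun a i => if a = π i then 1 else 0

/-- The squared Frobenius norm `∑ i j, (M i j) ^ 2`. -/
def frobeniusSq {n : ℕ} (M : Matrix (Fin n) (Fin n) ℝ) : ℝ :=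
  ∑ i, ∑ j, M i j ^ 2

/-- The objective `‖G₁ - Π G₂ Πᵀ‖_F²` of the quadratic assignment problem. -/
def qapCost {n : ℕ} (G₁ G₂ : SimpleGraph (Fin n)) (π : Equiv.Perm (Fin n)) : ℝ :=
  frobeniusSq (adj G₁ - permMat π * adj G₂ * (permMat π).transpose)

open Classical in
/-- The set of minimizers of `c` over the finite set `S`. -/
def argminSet {β : Type} (c : β → ℝ) (S : Finset β) : Finset β :=
  S.filter fun a => ∀ b ∈ S, c a ≤ c b

open Classical in
/-- The seedless matching algorithm on input `(G₁, G₂)`. It draws `S ⊆ [n]`, each vertex being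
included independently with probability `α`, calls the seeded algorithm once for each of the
mappings `f : S → [n]`, and outputs an element `π_f` of least cost `‖G₁ - Π_f G₂ Π_fᵀ‖_F²` among
the answers; `tie` picks an element of the set of all minimizers. -/
def seedlessMatching {n : ℕ} (α : I)
    (tie : SimpleGraph (Fin n) → SimpleGraph (Fin n) →
      Finset (Equiv.Perm (Fin n)) → Equiv.Perm (Fin n))
    (G₁ G₂ : SimpleGraph (Fin n)) :
    OracleProgram (SeededInput n) (Equiv.Perm (Fin n)) (Equiv.Perm (Fin n)) :=
  .sample (randomSubset n α) fun S =>
  .callAll ((Finset.univ : Finset (S → Fin n)).toList.map fun f => (G₁, G₂, seedMap S f))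
    fun answers => .ret (tie G₁ G₂ (argminSet (qapCost G₁ G₂) answers.toFinset))

/-- The joint law, under the seedless model `𝒢(n, p; s)`, of `(π̂, N, π*)`, where `π̂` is the
output of the seedless matching algorithm run with the seeded algorithm `A`, and `N` is the number
of its calls of `A`. -/
def seedlessRun (n : ℕ) (p s α : I) (A : SeededAlg n)
    (tie : SimpleGraph (Fin n) → SimpleGraph (Fin n) →
      Finset (Equiv.Perm (Fin n)) → Equiv.Perm (Fin n)) :
    PMF (Equiv.Perm (Fin n) × ℕ × Equiv.Perm (Fin n)) :=
  (correlatedER n p s).bind fun x =>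
  ((seedlessMatching α tie x.1 x.2.1).run A).map fun y => (y.1, y.2, x.2.2)

end GraphMatching

end

/-!
If `π*` is the unique minimizer of the quadratic assignment problem, then the seedless algorithm is
correct as soon as one of its calls returns `π*`, and the call with the true seeds does so with the
success probability of the seeded algorithm. The number of calls is `n ^ |I₀|`, and
`|I₀| ≤ 3 α n` with high probability by a Chernoff bound.

It remains to show that, above the connectivity threshold of the intersection graph, no nontrivial
permutation `τ` of the vertices achieves the overlap of the identity. The exponential moment of a
product over the cycles of the permutation that `τ` induces on pairs of vertices factors into
traces of powers of a two-state transfer matrix, and these are at most powers of its Frobenius norm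
once the matrix has been symmetrized. This gives, per moved pair, an error rate close to
`p s² (1 - √p)² (1 - p s)`. A union bound over `τ` is enough for permutations moving few vertices
and for dense graphs; for sparse graphs and large supports, the support is incident to many common
edges while hardly any moved pair is mapped from an edge to an edge.
-/

namespace GraphMatching

open MeasureTheory

/-! ## Reduction to uniqueness of the minimizer -/

theorem mapM_cons_eq_bind {Q R : Type} (O : Q → PMF R) (q : Q) (qs : List Q) :
    (q :: qs).mapM O = (O q).bind fun r => (qs.mapM O).map (List.cons r) := by
  rw [List.mapM_cons]
  rfl

theorem OracleProgram.run_callAll {Q R A : Type} (O : Q → PMF R) (qs : List Q)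
    (k : List R → OracleProgram Q R A) :
    (callAll qs k).run O =
      (qs.mapM O).bind fun rs => ((k rs).run O).map fun x => (x.1, x.2 + qs.length) := by
  induction qs generalizing k with
  | nil =>
    have hnil : ([] : List Q).mapM O = PMF.pure [] := List.mapM_nil
    simp only [hnil, callAll, List.length_nil, add_zero, PMF.pure_bind]
    exact (PMF.map_id _).symm
  | cons q qs ih =>
    simp only [callAll, run, ih, mapM_cons_eq_bind, PMF.bind_bind, PMF.bind_map, PMF.map_bind,
      PMF.map_comp, List.length_cons]
    rfl

theorem le_toOuterMeasure_mapM_mem {Q R : Type} (O : Q → PMF R) {qs : List Q} {q : Q}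
    (hq : q ∈ qs) (r : R) : O q r ≤ (qs.mapM O).toOuterMeasure {rs | r ∈ rs} := by
  induction qs with
  | nil => simp at hq
  | cons q' qs ih =>
    rw [mapM_cons_eq_bind, PMF.toOuterMeasure_bind_apply]
    simp only [PMF.toOuterMeasure_map_apply]
    rcases List.mem_cons.1 hq with rfl | hq
    · have hone : (qs.mapM O).toOuterMeasure (List.cons r ⁻¹' {rs | r ∈ rs}) = 1 :=
        (PMF.toOuterMeasure_apply_eq_one_iff _ _).2 fun rs _ => List.mem_cons_self
      refine le_trans ?_ (ENNReal.le_tsum r)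
      rw [hone, mul_one]
    · calc O q r = ∑' r', O q' r' * O q r := by
            rw [ENNReal.tsum_mul_right, PMF.tsum_coe, one_mul]
        _ ≤ _ := ENNReal.tsum_le_tsum fun r' => by
            gcongr
            exact (ih hq).trans (measure_mono fun rs => List.mem_cons_of_mem r')

theorem toOuterMeasure_bind_le_add {β γ δ : Type*} (μ : PMF β) {f : β → PMF γ} {g : β → PMF δ}
    {T : Set γ} {U : Set δ} {B : Set β} {ε : ℝ≥0∞}
    (h : ∀ x ∉ B, (f x).toOuterMeasure T ≤ (g x).toOuterMeasure U + ε) :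
    (μ.bind f).toOuterMeasure T ≤ (μ.bind g).toOuterMeasure U + μ.toOuterMeasure B + ε := by
  classical
  have hpoint : ∀ x, μ x * (f x).toOuterMeasure T ≤
      μ x * (g x).toOuterMeasure U + B.indicator μ x + μ x * ε := by
    intro x
    by_cases hx : x ∈ B
    · rw [Set.indicator_of_mem hx]
      have hone : (f x).toOuterMeasure T ≤ 1 :=
        (measure_mono (Set.subset_univ T)).trans_eq
          ((PMF.toOuterMeasure_apply_eq_one_iff _ _).2 (Set.subset_univ _))
      exact (mul_le_of_le_one_right' hone).trans (le_add_right le_add_self)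
    · rw [Set.indicator_of_notMem hx, add_zero, ← mul_add]
      gcongr
      exact h x hx
  calc (μ.bind f).toOuterMeasure T
      = ∑' x, μ x * (f x).toOuterMeasure T := PMF.toOuterMeasure_bind_apply ..
    _ ≤ ∑' x, (μ x * (g x).toOuterMeasure U + B.indicator μ x + μ x * ε) :=
        ENNReal.tsum_le_tsum hpoint
    _ = (μ.bind g).toOuterMeasure U + μ.toOuterMeasure B + ε := by
        rw [ENNReal.tsum_add, ENNReal.tsum_add, ENNReal.tsum_mul_right, PMF.tsum_coe, one_mul,
          PMF.toOuterMeasure_bind_apply, PMF.toOuterMeasure_apply]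

theorem argminSet_eq_singleton {β : Type} {c : β → ℝ} {S : Finset β} {b : β} (hb : b ∈ S)
    (hlt : ∀ b' ∈ S, b' ≠ b → c b < c b') : argminSet c S = {b} := by
  classical
  refine Finset.eq_singleton_iff_unique_mem.2
    ⟨Finset.mem_filter.2 ⟨hb, fun b' hb' => ?_⟩, fun x hx => ?_⟩
  · obtain rfl | hne := eq_or_ne b' b
    exacts [le_rfl, (hlt b' hb' hne).le]
  · obtain ⟨hxS, hx⟩ := Finset.mem_filter.1 hx
    by_contra hne
    exact (hlt x hxS hne).not_ge (hx b hb)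

/-- The event that `π*` is not the only minimizer of the quadratic assignment problem. -/
def NotUniqueMin {n : ℕ} (x : SimpleGraph (Fin n) × SimpleGraph (Fin n) × Equiv.Perm (Fin n)) :
    Prop :=
  ∃ π, π ≠ x.2.2 ∧ qapCost x.1 x.2.1 π ≤ qapCost x.1 x.2.1 x.2.2

section

variable {n : ℕ} {tie : SimpleGraph (Fin n) → SimpleGraph (Fin n) →
  Finset (Equiv.Perm (Fin n)) → Equiv.Perm (Fin n)}

theorem tie_argminSet_eq (htie : ∀ G₁ G₂ S, S.Nonempty → tie G₁ G₂ S ∈ S)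
    {G₁ G₂ : SimpleGraph (Fin n)} {π : Equiv.Perm (Fin n)} (hmin : ¬ NotUniqueMin (G₁, G₂, π))
    {S : Finset (Equiv.Perm (Fin n))} (hπ : π ∈ S) :
    tie G₁ G₂ (argminSet (qapCost G₁ G₂) S) = π := by
  have hsingle : argminSet (qapCost G₁ G₂) S = {π} :=
    argminSet_eq_singleton hπ fun π' _ hne => not_le.1 fun hle => hmin ⟨π', hne, hle⟩
  simpa [hsingle] using htie G₁ G₂ {π} (Finset.singleton_nonempty π)

open Classical in
theorem le_toOuterMeasure_run_callAll_argmin (A : SeededAlg n)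
    (htie : ∀ G₁ G₂ S, S.Nonempty → tie G₁ G₂ S ∈ S)
    {G₁ G₂ : SimpleGraph (Fin n)} {π : Equiv.Perm (Fin n)} (hmin : ¬ NotUniqueMin (G₁, G₂, π))
    (S : Set (Fin n)) :
    A (G₁, G₂, seedMap S fun i => π i) π ≤
      ((OracleProgram.callAll
        ((Finset.univ : Finset (S → Fin n)).toList.map fun f => (G₁, G₂, seedMap S f))
        fun answers => .ret (tie G₁ G₂ (argminSet (qapCost G₁ G₂) answers.toFinset))).run
          A).toOuterMeasure {y | y = (π, n ^ S.ncard)} := by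
  have hlen : ((Finset.univ : Finset (S → Fin n)).toList.map
      fun f => (G₁, G₂, seedMap S f)).length = n ^ S.ncard := by
    simp [Nat.card_eq_fintype_card, ← Nat.card_coe_set_eq]
  have hq : (G₁, G₂, seedMap S fun i => π i) ∈ (Finset.univ : Finset (S → Fin n)).toList.map
      fun f => (G₁, G₂, seedMap S f) := List.mem_map.2 ⟨_, by simp, rfl⟩
  simp only [OracleProgram.run_callAll, OracleProgram.run, PMF.pure_map, hlen, zero_add]
  refine (le_toOuterMeasure_mapM_mem A hq π).trans ?_
  rw [← Function.comp_def PMF.pure, PMF.bind_pure_comp, PMF.toOuterMeasure_map_apply]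
  exact measure_mono fun rs hrs =>
    Prod.ext (tie_argminSet_eq htie hmin (List.mem_toFinset.2 hrs)) rfl

theorem seededSuccess_le (p s α : I) (A : SeededAlg n)
    (htie : ∀ G₁ G₂ S, S.Nonempty → tie G₁ G₂ S ∈ S) (N : ℝ) :
    seededSuccess n p s α A ≤
      (seedlessRun n p s α A tie).toOuterMeasure {y | y.1 = y.2.2 ∧ (y.2.1 : ℝ) ≤ N} +
      (correlatedER n p s).toOuterMeasure {x | NotUniqueMin x} +
      (randomSubset n α).toOuterMeasure {S | N < (n : ℝ) ^ S.ncard} := by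
  rw [seededSuccess, seededModel, PMF.bind_bind, seedlessRun]
  refine toOuterMeasure_bind_le_add _ fun x hx => ?_
  simp only [seedlessMatching, OracleProgram.run, PMF.map_bind, PMF.bind_bind, PMF.pure_bind]
  refine (toOuterMeasure_bind_le_add (ε := 0) _ fun S hS => ?_).trans_eq (add_zero _)
  simp only [PMF.toOuterMeasure_map_apply, add_zero]
  refine le_trans ?_ ((le_toOuterMeasure_run_callAll_argmin A htie hx S).trans (measure_mono ?_))
  · rw [← PMF.toOuterMeasure_apply_singleton (A _)]
    rfl
  · rintro y rfl
    exact ⟨rfl, by simpa using hS⟩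

end

/-! ## The number of seeds -/

theorem randomSubset_apply (n : ℕ) (α : I) (S : Set (Fin n)) :
    randomSubset n α S =
      ENNReal.ofReal ((α : ℝ) ^ S.ncard * (1 - α : ℝ) ^ (n - S.ncard)) := by
  have hcompl : ((Set.univ : Set (Fin n)) \ S).ncard = n - S.ncard := by
    rw [Set.ncard_sdiff (Set.subset_univ _), Set.ncard_univ, Nat.card_fin]
  rw [randomSubset, Measure.toPMF_apply, ← hcompl,
    ← ProbabilityTheory.setBernoulli_real_singleton _ (Set.subset_univ _) (Set.toFinite _),
    ofReal_measureReal]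

theorem sum_pow_ncard_mul_pow_sub_ncard (n : ℕ) (a b : ℝ) :
    ∑ S : Set (Fin n), a ^ S.ncard * b ^ (n - S.ncard) = (a + b) ^ n := by
  classical
  simpa [← Fintype.finsetEquivSet.sum_comp] using Fintype.sum_pow_mul_eq_add_pow (Fin n) a b

theorem toOuterMeasure_randomSubset_lt_ncard_le (n : ℕ) (α : I) (x : ℝ) :
    (randomSubset n α).toOuterMeasure {S | x < S.ncard} ≤
      ENNReal.ofReal (Real.exp (2 * (α * n) - x)) := by
  classical
  have hα := α.2.1
  have hα' : 0 ≤ 1 - (α : ℝ) := sub_nonneg.2 α.2.2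
  let g : Set (Fin n) → ℝ := fun S =>
    Real.exp (-x) * ((Real.exp 1 * α) ^ S.ncard * (1 - α : ℝ) ^ (n - S.ncard))
  have hmarkov : ∀ S, Set.indicator {S : Set (Fin n) | x < S.ncard} (randomSubset n α) S ≤
      ENNReal.ofReal (g S) := by
    intro S
    refine Set.indicator_apply_le (g := fun S => ENNReal.ofReal (g S)) fun hS => ?_
    rw [randomSubset_apply]
    refine ENNReal.ofReal_le_ofReal ?_
    have hexp : 1 ≤ Real.exp (-x) * Real.exp 1 ^ S.ncard := by
      rw [← Real.exp_nat_mul, ← Real.exp_add, Real.one_le_exp_iff]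
      linarith [Set.mem_ofPred_eq ▸ hS]
    simp only [g, mul_pow, ← mul_assoc]
    rw [mul_assoc _ (_ ^ _) (_ ^ _)]
    exact le_mul_of_one_le_left (by positivity) hexp
  calc (randomSubset n α).toOuterMeasure {S | x < S.ncard}
      ≤ ∑ S, ENNReal.ofReal (g S) := by
        rw [PMF.toOuterMeasure_apply_fintype]
        exact Finset.sum_le_sum fun S _ => hmarkov S
    _ = ENNReal.ofReal (Real.exp (-x) * (Real.exp 1 * α + (1 - α)) ^ n) := by
        rw [← ENNReal.ofReal_sum_of_nonneg fun S _ => by positivity, ← Finset.mul_sum,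
          sum_pow_ncard_mul_pow_sub_ncard]
    _ ≤ ENNReal.ofReal (Real.exp (-x) * Real.exp (2 * α) ^ n) := by
        gcongr
        nlinarith [Real.add_one_le_exp (2 * α : ℝ), Real.exp_one_lt_three]
    _ = ENNReal.ofReal (Real.exp (2 * (α * n) - x)) := by
        rw [← Real.exp_nat_mul, ← Real.exp_add]
        ring_nf

theorem toOuterMeasure_randomSubset_rpow_lt_pow_ncard_le {n : ℕ} (hn : 1 ≤ n) (α : I) :
    (randomSubset n α).toOuterMeasure
        {S | (n : ℝ) ^ (3 * ((α : ℝ) * n)) < (n : ℝ) ^ S.ncard} ≤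
      ENNReal.ofReal (Real.exp (-(α * n))) := by
  have hn' : (1 : ℝ) ≤ n := by exact_mod_cast hn
  calc (randomSubset n α).toOuterMeasure {S | (n : ℝ) ^ (3 * ((α : ℝ) * n)) < (n : ℝ) ^ S.ncard}
      ≤ (randomSubset n α).toOuterMeasure {S | 3 * ((α : ℝ) * n) < S.ncard} := by
        refine measure_mono fun S hS => ?_
        simp only [Set.mem_ofPred_eq] at hS ⊢
        contrapose! hS
        rw [← Real.rpow_natCast]
        exact Real.rpow_le_rpow_of_exponent_le hn' hS
    _ ≤ ENNReal.ofReal (Real.exp (-(α * n))) := by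
        refine (toOuterMeasure_randomSubset_lt_ncard_le n α _).trans_eq ?_
        ring_nf

/-! ## Edge configurations -/

section Configurations

variable {V : Type*}

/-- The unordered pairs of distinct vertices. -/
abbrev Pairs (V : Type*) : Type _ := {e : Sym2 V // ¬ e.IsDiag}

/-- The permutation of the pairs of vertices induced by a permutation of the vertices. -/
def pairPerm (π : Equiv.Perm V) : Equiv.Perm (Pairs V) where
  toFun e := ⟨e.1.map π, by rw [Sym2.isDiag_map π.injective]; exact e.2⟩
  invFun e := ⟨e.1.map π.symm, by rw [Sym2.isDiag_map π.symm.injective]; exact e.2⟩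
  left_inv e := by ext1; simp [Sym2.map_map]
  right_inv e := by ext1; simp [Sym2.map_map]

@[simp] theorem coe_pairPerm (π : Equiv.Perm V) (e : Pairs V) :
    (pairPerm π e : Sym2 V) = e.1.map π := rfl

@[simp] theorem pairPerm_one : pairPerm (1 : Equiv.Perm V) = 1 := by
  ext e
  simp

open Classical in
/-- The correspondence between graphs and the indicator functions of their edge sets. -/
noncomputable def edgeIndicator : SimpleGraph V ≃ (Pairs V → Bool) where
  toFun G e := decide (e.1 ∈ G.edgeSet)
  invFun a := SimpleGraph.fromEdgeSet {e | ∃ h, a ⟨e, h⟩ = true}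
  left_inv G := by
    ext i j
    simpa [SimpleGraph.fromEdgeSet_adj] using
      (⟨fun h => h.1.2, fun h => ⟨⟨h.ne, h⟩, h.ne⟩⟩ : (i ≠ j ∧ G.Adj i j) ∧ i ≠ j ↔ G.Adj i j)
  right_inv a := by
    ext ⟨e, he⟩
    simp [SimpleGraph.edgeSet_fromEdgeSet, he]

theorem edgeIndicator_apply (G : SimpleGraph V) (e : Pairs V) [Decidable (e.1 ∈ G.edgeSet)] :
    edgeIndicator G e = decide (e.1 ∈ G.edgeSet) := by
  simp [edgeIndicator]

theorem edgeIndicator_eq_true {G : SimpleGraph V} {e : Pairs V} :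
    edgeIndicator G e = true ↔ e.1 ∈ G.edgeSet := by
  classical
  rw [edgeIndicator_apply, decide_eq_true_eq]

/-- The correspondence between pairs of graphs and configurations, which record for every pair of
vertices whether it is an edge of the first and of the second graph. -/
noncomputable def edgeConfig : SimpleGraph V × SimpleGraph V ≃ (Pairs V → Bool × Bool) :=
  (edgeIndicator.prodCongr edgeIndicator).trans (Equiv.arrowProdEquivProdArrow _ _ _).symm

@[simp] theorem edgeConfig_apply (G : SimpleGraph V × SimpleGraph V) (e : Pairs V) :
    edgeConfig G e = (edgeIndicator G.1 e, edgeIndicator G.2 e) := rfl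

/-- The number of `e` such that `τ e` is an edge of the first graph and `e` one of the second. -/
def overlap {F : Type*} [Fintype F] (τ : Equiv.Perm F) (w : F → Bool × Bool) : ℕ :=
  (Finset.univ.filter fun e => (w (τ e)).1 ∧ (w e).2).card

/-- Some nontrivial permutation of the vertices achieves at least the overlap of the identity. -/
def Confusable [Fintype V] [DecidableEq V] (w : Pairs V → Bool × Bool) : Prop :=
  ∃ τ : Equiv.Perm V, τ ≠ 1 ∧ overlap 1 w ≤ overlap (pairPerm τ) w

theorem card_filter_mk_eq [Fintype V] [DecidableEq V] {e : Sym2 V} (he : ¬ e.IsDiag) :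
    (Finset.univ.filter fun x : V × V => s(x.1, x.2) = e).card = 2 := by
  induction e using Sym2.ind with
  | _ x y =>
    have hxy : x ≠ y := by simpa using he
    rw [show (Finset.univ.filter fun z : V × V => s(z.1, z.2) = s(x, y)) = {(x, y), (y, x)} by
      ext ⟨u, v⟩; simp, Finset.card_pair (by simp [hxy])]

theorem sum_sum_sym2 [Fintype V] [DecidableEq V] {h : Sym2 V → ℝ}
    (h0 : ∀ e, e.IsDiag → h e = 0) :
    ∑ i, ∑ j, h s(i, j) = 2 * ∑ e : Pairs V, h e.1 := by
  have hfiber : ∀ e, ∑ x : V × V with s(x.1, x.2) = e, h s(x.1, x.2) = 2 * h e := by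
    intro e
    rw [Finset.sum_congr rfl fun x hx => by rw [(Finset.mem_filter.1 hx).2], Finset.sum_const,
      nsmul_eq_mul]
    by_cases he : e.IsDiag
    · simp [h0 e he]
    · simp [card_filter_mk_eq he]
  calc ∑ i, ∑ j, h s(i, j) = ∑ e, ∑ x : V × V with s(x.1, x.2) = e, h s(x.1, x.2) := by
        rw [Finset.sum_fiberwise, Fintype.sum_prod_type]
    _ = 2 * ∑ e, h e := by simp only [hfiber, Finset.mul_sum]
    _ = 2 * ∑ e : Pairs V, h e.1 := by
        congr 1
        refine (Fintype.sum_of_injective _ Subtype.val_injective _ _ (fun e he => ?_)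
          fun _ => rfl).symm
        exact h0 e (by simpa using he)

end Configurations

section Cost

variable {n : ℕ}

theorem qapCost_eq_sum (G₁ G₂ : SimpleGraph (Fin n)) (π : Equiv.Perm (Fin n)) :
    qapCost G₁ G₂ π = ∑ i, ∑ j, (adj G₁ (π i) (π j) - adj G₂ i j) ^ 2 := by
  have hperm : ∀ a i, permMat π a i = if i = π.symm a then 1 else 0 := fun a i => by
    simp only [permMat, Matrix.of_apply, Equiv.eq_symm_apply, eq_comm]
  have hconj : ∀ i j, (permMat π * adj G₂ * (permMat π).transpose) i j =
      adj G₂ (π.symm i) (π.symm j) := fun i j => by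
    simp [Matrix.mul_apply, Matrix.transpose_apply, hperm]
  simp only [qapCost, frobeniusSq, Matrix.sub_apply, hconj]
  rw [← Equiv.sum_comp π]
  refine Finset.sum_congr rfl fun i _ => ?_
  rw [← Equiv.sum_comp π]
  simp

theorem qapCost_map (A B : SimpleGraph (Fin n)) (π π' : Equiv.Perm (Fin n)) :
    qapCost (A.map π) B π' = 2 * (((Finset.univ.filter fun e => edgeIndicator A e).card : ℝ) +
      (Finset.univ.filter fun e => edgeIndicator B e).card -
      2 * overlap (pairPerm (π⁻¹ * π')) (edgeConfig (A, B))) := by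
  classical
  set τ := π⁻¹ * π' with hτ
  let h : Sym2 (Fin n) → ℝ := fun e =>
    ((if e.map τ ∈ A.edgeSet then 1 else 0) - (if e ∈ B.edgeSet then 1 else 0)) ^ 2
  have hdiag : ∀ e : Sym2 (Fin n), e.IsDiag → h e = 0 := fun e he => by
    have hA : e.map τ ∉ A.edgeSet := fun h => A.not_isDiag_of_mem_edgeSet h
      ((Sym2.isDiag_map τ.injective).2 he)
    have hB : e ∉ B.edgeSet := fun h => B.not_isDiag_of_mem_edgeSet h he
    simp [h, hA, hB]
  have hcost : qapCost (A.map π) B π' = ∑ i, ∑ j, h s(i, j) := by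
    have hπ' : ∀ i, π' i = π (τ i) := fun i => by simp [hτ]
    have hadj : ∀ i j, (A.map π).Adj (π (τ i)) (π (τ j)) ↔ A.Adj (τ i) (τ j) := fun i j =>
      SimpleGraph.map_adj_apply (f := π.toEmbedding)
    simp only [qapCost_eq_sum, hπ', adj, SimpleGraph.adjMatrix_apply, hadj, h, Sym2.map_mk,
      SimpleGraph.mem_edgeSet]
  have hsum : ∀ e : Pairs (Fin n), h e.1 = (if edgeIndicator A (pairPerm τ e) then 1 else 0) +
      (if edgeIndicator B e then 1 else 0) -
      2 * (if edgeIndicator A (pairPerm τ e) ∧ edgeIndicator B e then 1 else 0) := fun e => by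
    simp only [h, edgeIndicator_eq_true, coe_pairPerm]
    by_cases hA : e.1.map τ ∈ A.edgeSet <;> by_cases hB : e.1 ∈ B.edgeSet <;>
      simp only [hA, hB, if_true, if_false, and_true, and_false] <;> norm_num
  rw [hcost, sum_sum_sym2 hdiag, Finset.sum_congr rfl fun e _ => hsum e, Finset.sum_sub_distrib,
    Finset.sum_add_distrib, ← Finset.mul_sum,
    Equiv.sum_comp (pairPerm τ) fun e => if edgeIndicator A e then (1 : ℝ) else 0]
  simp only [Finset.sum_boole]
  rfl

theorem Confusable.of_notUniqueMin {A B : SimpleGraph (Fin n)} {π : Equiv.Perm (Fin n)}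
    (h : NotUniqueMin (A.map π, B, π)) : Confusable (edgeConfig (A, B)) := by
  obtain ⟨π', hne, hle⟩ := h
  refine ⟨π⁻¹ * π', fun h => hne (inv_mul_eq_one.1 h).symm, ?_⟩
  dsimp only at hle
  rw [qapCost_map, qapCost_map, inv_mul_cancel, pairPerm_one] at hle
  exact_mod_cast (by linarith :
    (overlap 1 (edgeConfig (A, B)) : ℝ) ≤ overlap (pairPerm (π⁻¹ * π')) (edgeConfig (A, B)))

end Cost

/-! ## The joint law of the two subsamples -/

/-- The law of the state of an edge after subsampling, when its state before is `b`. -/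
noncomputable def thin (s : I) (b : Bool) : PMF Bool :=
  (ProbabilityTheory.bernoulliMeasure b false s).toPMF

/-- The joint law of the states of a pair of vertices in the two subsamples. -/
noncomputable def edgePairLaw (p s : I) : PMF (Bool × Bool) :=
  (thin p true).bind fun z => (thin s z).bind fun x => (thin s z).map fun y => (x, y)

/-- The law of a configuration: the states of different elements of `F` are independent with law
`edgePairLaw p s`. -/
noncomputable abbrev configLaw (F : Type*) [Fintype F] (p s : I) :
    Measure (F → Bool × Bool) :=
  Measure.pi fun _ => (edgePairLaw p s).toMeasure

/-- The joint law of the two subsamples, before the vertices of the first one are relabelled. -/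
noncomputable def subsamplePair (n : ℕ) (p s : I) :
    PMF (SimpleGraph (Fin n) × SimpleGraph (Fin n)) :=
  (SimpleGraph.binomialRandom (Fin n) p).toPMF.bind fun G₀ =>
  (subsample s G₀).bind fun G₁ => (subsample s G₀).map fun G₂ => (G₁, G₂)

theorem bind_map_mk_apply {β γ : Type*} (μ : PMF β) (ν : PMF γ) (x : β × γ) :
    (μ.bind fun b => ν.map fun c => (b, c)) x = μ x.1 * ν x.2 := by
  rw [PMF.bind_apply, tsum_eq_single x.1, PMF.map_apply, tsum_eq_single x.2, if_pos rfl]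
  · exact fun c hc => if_neg fun h => hc (congr_arg Prod.snd h).symm
  · intro b hb
    rw [PMF.map_apply, ENNReal.tsum_eq_zero.2 fun c => if_neg fun h =>
      hb (congr_arg Prod.fst h).symm, mul_zero]

theorem edgePairLaw_apply (p s : I) (x : Bool × Bool) :
    edgePairLaw p s x = ∑ z, thin p true z * (thin s z x.1 * thin s z x.2) := by
  rw [edgePairLaw, PMF.bind_apply, tsum_fintype]
  simp only [bind_map_mk_apply]

theorem setBernoulli_singleton_eq_prod {ι : Type*} [Fintype ι] (s : I) (U T : Set ι)
    [DecidablePred (· ∈ U)] [DecidablePred (· ∈ T)] :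
    ProbabilityTheory.setBernoulli U s {T} =
      ∏ i, thin s (decide (i ∈ U)) (decide (i ∈ T)) := by
  have hpre : (fun t : ι → Prop => {i | t i}) ⁻¹' {T} = {fun i => i ∈ T} := by
    ext t
    simp [Set.ext_iff, funext_iff]
  rw [ProbabilityTheory.setBernoulli_apply', hpre, Measure.infinitePi_eq_pi, Measure.pi_singleton]
  refine Finset.prod_congr rfl fun i _ => ?_
  rw [thin, Measure.toPMF_apply, ProbabilityTheory.bernoulliMeasure_def]
  by_cases hU : i ∈ U <;> by_cases hT : i ∈ T <;> simp [hU, hT]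

theorem thin_false_false (s : I) : thin s false false = 1 := by
  simp [thin]

theorem prod_sym2_eq_prod_pairs {V : Type*} [Fintype V] [DecidableEq V] {f : Sym2 V → ℝ≥0∞}
    (hf : ∀ e, e.IsDiag → f e = 1) : ∏ e, f e = ∏ e : Pairs V, f e.1 :=
  (Fintype.prod_of_injective _ Subtype.val_injective _ _ (fun e he => hf e (by simpa using he))
    fun _ => rfl).symm

section

variable {n : ℕ}

theorem binomialRandom_apply_eq_prod (p : I) (G : SimpleGraph (Fin n)) :
    (SimpleGraph.binomialRandom (Fin n) p).toPMF G = ∏ e, thin p true (edgeIndicator G e) := by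
  classical
  rw [Measure.toPMF_apply, SimpleGraph.binomialRandom_apply', Set.image_singleton,
    setBernoulli_singleton_eq_prod, prod_sym2_eq_prod_pairs]
  · refine Finset.prod_congr rfl fun e _ => ?_
    rw [edgeIndicator_apply, decide_eq_true (by simpa using e.2)]
  · intro e he
    have hG : e ∉ G.edgeSet := fun h => G.not_isDiag_of_mem_edgeSet h he
    simp [he, hG, thin_false_false]

theorem subsample_apply_eq_prod (s : I) (G A : SimpleGraph (Fin n)) :
    subsample s G A = ∏ e, thin s (edgeIndicator G e) (edgeIndicator A e) := by
  classical
  have hsingle : subsample s G A = ProbabilityTheory.setBernoulli G.edgeSet s {A.edgeSet} := by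
    rw [subsample, PMF.map_apply, tsum_eq_single A.edgeSet, if_pos (by simp),
      Measure.toPMF_apply]
    intro S hS
    split_ifs with hA
    · rw [Measure.toPMF_apply]
      refine ProbabilityTheory.setBernoulli_singleton_of_not_subset s fun hSG => hS ?_
      rw [hA, SimpleGraph.edgeSet_fromEdgeSet]
      exact (sdiff_eq_left.2 (Set.disjoint_left.2 fun e he hd =>
        G.not_isDiag_of_mem_edgeSet (hSG he) hd)).symm
    · rfl
  rw [hsingle, setBernoulli_singleton_eq_prod, prod_sym2_eq_prod_pairs]
  · simp only [edgeIndicator_apply]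
  · intro e he
    have hG : e ∉ G.edgeSet := fun h => G.not_isDiag_of_mem_edgeSet h he
    have hA : e ∉ A.edgeSet := fun h => A.not_isDiag_of_mem_edgeSet h he
    simp [hG, hA, thin_false_false]

theorem subsamplePair_apply_eq_prod (p s : I) (G : SimpleGraph (Fin n) × SimpleGraph (Fin n)) :
    subsamplePair n p s G = ∏ e, edgePairLaw p s (edgeConfig G e) := by
  classical
  rw [subsamplePair, PMF.bind_apply, tsum_fintype]
  simp only [bind_map_mk_apply, edgePairLaw_apply, Fintype.prod_sum]
  rw [← edgeIndicator.sum_comp]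
  refine Finset.sum_congr rfl fun G₀ _ => ?_
  simp only [binomialRandom_apply_eq_prod, subsample_apply_eq_prod, Finset.prod_mul_distrib,
    edgeConfig_apply]

theorem subsamplePair_map_edgeConfig (p s : I) :
    ((subsamplePair n p s).map edgeConfig).toMeasure = configLaw (Pairs (Fin n)) p s := by
  classical
  refine Measure.ext_of_singleton fun w => ?_
  obtain ⟨G, rfl⟩ := edgeConfig.surjective w
  rw [PMF.toMeasure_apply_singleton _ _ (measurableSet_singleton _), PMF.map_apply,
    Measure.pi_singleton, tsum_eq_single G, if_pos rfl, subsamplePair_apply_eq_prod]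
  · refine Finset.prod_congr rfl fun e _ => ?_
    rw [PMF.toMeasure_apply_singleton _ _ (measurableSet_singleton _)]
  · exact fun H hH => if_neg fun h => hH (edgeConfig.injective h.symm)

theorem correlatedER_eq_bind (p s : I) :
    correlatedER n p s = (subsamplePair n p s).bind fun G =>
      (PMF.uniformOfFintype (Equiv.Perm (Fin n))).map fun π : Equiv.Perm (Fin n) =>
        (G.1.map π, G.2, π) := by
  simp only [correlatedER, subsamplePair, PMF.bind_bind, PMF.bind_map]
  rfl

theorem correlatedER_notUniqueMin_le (p s : I) :
    (correlatedER n p s).toOuterMeasure {x | NotUniqueMin x} ≤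
      configLaw (Pairs (Fin n)) p s {w | Confusable w} := by
  classical
  rw [← subsamplePair_map_edgeConfig, PMF.toMeasure_apply_eq_toOuterMeasure,
    PMF.toOuterMeasure_map_apply, correlatedER_eq_bind]
  refine (toOuterMeasure_bind_le_add (g := PMF.pure) (U := ∅)
    (B := edgeConfig ⁻¹' {w | Confusable w}) (ε := 0) _ fun G hG => ?_).trans_eq ?_
  · rw [PMF.toOuterMeasure_map_apply]
    have hempty :
        (fun π : Equiv.Perm (Fin n) => (G.1.map π, G.2, π)) ⁻¹' {x | NotUniqueMin x} = ∅ :=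
      Set.eq_empty_of_forall_notMem fun π hπ => hG (Confusable.of_notUniqueMin hπ)
    simp [hempty]
  · simp

end

/-! ## Cyclic products over a permutation -/

section CyclicProducts

variable {F κ : Type*} {τ : Equiv.Perm F}

theorem eq_of_sameCycle {J : F → κ} (hJ : ∀ e, J (τ e) = J e) {x y : F}
    (h : τ.SameCycle x y) : J x = J y := by
  have hpow : ∀ i : ℤ, ∀ e, J ((τ ^ i) e) = J e := by
    intro i
    induction i with
    | zero => exact fun e => rfl
    | succ i ih => intro e; rw [zpow_add_one, Equiv.Perm.mul_apply, ih, hJ]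
    | pred i ih =>
      intro e
      rw [zpow_sub_one, Equiv.Perm.mul_apply, ih, ← hJ (τ⁻¹ e), ← Equiv.Perm.mul_apply,
        mul_inv_cancel, Equiv.Perm.one_apply]
  obtain ⟨i, rfl⟩ := h
  exact (hpow i x).symm

/-- The set of cycles of a permutation, fixed points included. -/
abbrev Cycles (τ : Equiv.Perm F) : Type _ := Quotient (Equiv.Perm.SameCycle.setoid τ)

/-- The cycle of `τ` containing a given point. -/
abbrev cycleMk (τ : Equiv.Perm F) (e : F) : Cycles τ := Quotient.mk _ e

variable [Fintype F] [Fintype κ]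

theorem abs_sum_pow_le_sqrt_pow (l : κ → ℝ) {k : ℕ} (hk : 2 ≤ k) :
    |∑ j, l j ^ k| ≤ √(∑ j, l j ^ 2) ^ k := by
  set q := √(∑ j, l j ^ 2)
  have hq : q ^ 2 = ∑ j, l j ^ 2 := Real.sq_sqrt (Finset.sum_nonneg fun _ _ => sq_nonneg _)
  have hl (j : κ) : |l j| ≤ q := Real.abs_le_sqrt
    (Finset.single_le_sum (f := fun j => l j ^ 2) (fun _ _ => sq_nonneg _) (Finset.mem_univ j))
  obtain ⟨k, rfl⟩ := Nat.exists_eq_add_of_le hk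
  calc |∑ j, l j ^ (2 + k)| ≤ ∑ j, |l j ^ (2 + k)| := Finset.abs_sum_le_sum_abs _ _
    _ ≤ ∑ j, l j ^ 2 * q ^ k := by
        refine Finset.sum_le_sum fun j _ => ?_
        rw [abs_pow, pow_add, sq_abs]
        gcongr
        exact hl j
    _ = q ^ (2 + k) := by rw [← Finset.sum_mul, ← hq, pow_add]

theorem exists_spectral_decomposition [DecidableEq κ] {K : κ → κ → ℝ} (hK : ∀ x y, K x y = K y x) :
    ∃ (U : κ → κ → ℝ) (l : κ → ℝ), (∀ x y, K x y = ∑ j, l j * (U x j * U y j)) ∧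
      ∀ i j, ∑ x, U x i * U x j = if i = j then 1 else 0 := by
  have hH : (Matrix.of K).IsHermitian := by
    ext x y
    simp [hK x y]
  refine ⟨fun x j => hH.eigenvectorUnitary.1 x j, hH.eigenvalues, fun x y => ?_, fun i j => ?_⟩
  · have h := congrFun (congrFun hH.spectral_theorem x) y
    rw [Unitary.conjStarAlgAut_apply, Matrix.mul_apply] at h
    simp only [Matrix.of_apply] at h
    rw [h]
    refine Finset.sum_congr rfl fun j _ => ?_
    rw [Matrix.mul_diagonal]
    simp only [Function.comp_apply, RCLike.ofReal_real_eq_id, id_eq, Matrix.star_apply,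
      star_trivial]
    ring
  · have h := congrFun (congrFun (Unitary.coe_star_mul_self hH.eigenvectorUnitary) i) j
    rw [Matrix.mul_apply, Matrix.one_apply] at h
    simpa [Matrix.star_apply] using h

theorem sum_sum_sq_eq_sum_sq {ι : Type*} [Fintype ι] [DecidableEq ι] {K : κ → κ → ℝ}
    {U : κ → ι → ℝ} {l : ι → ℝ} (hKU : ∀ x y, K x y = ∑ j, l j * (U x j * U y j))
    (hU : ∀ i j, ∑ x, U x i * U x j = if i = j then 1 else 0) :
    ∑ x, ∑ y, K x y ^ 2 = ∑ j, l j ^ 2 :=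
  calc ∑ x, ∑ y, K x y ^ 2
      = ∑ x, ∑ y, ∑ i, ∑ j, l i * l j * ((U x i * U x j) * (U y i * U y j)) := by
        refine Finset.sum_congr rfl fun x _ => Finset.sum_congr rfl fun y _ => ?_
        rw [hKU, sq, Finset.sum_mul_sum]
        exact Finset.sum_congr rfl fun i _ => Finset.sum_congr rfl fun j _ => by ring
    _ = ∑ i, ∑ j, l i * l j * ((∑ x, U x i * U x j) * (∑ y, U y i * U y j)) := by
        simp_rw [Finset.sum_mul_sum, Finset.mul_sum]
        rw [Finset.sum_congr rfl fun x _ => Finset.sum_comm, Finset.sum_comm]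
        refine Finset.sum_congr rfl fun i _ => ?_
        rw [Finset.sum_congr rfl fun x _ => Finset.sum_comm, Finset.sum_comm]
    _ = ∑ j, l j ^ 2 := by
        simp [hU, sq]

variable [DecidableEq F]

theorem filter_invariant_eq_image [DecidableEq κ] (τ : Equiv.Perm F)
    [Fintype (Cycles τ)] [DecidableEq (Cycles τ)] :
    (Finset.univ.filter fun J : F → κ => ∀ e, J (τ e) = J e) =
      Finset.univ.image fun (g : Cycles τ → κ) e => g (cycleMk τ e) := by
  ext J
  simp only [Finset.mem_filter, Finset.mem_univ, true_and, Finset.mem_image]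
  constructor
  · exact fun hJ => ⟨Quotient.lift J fun _ _ => eq_of_sameCycle hJ, rfl⟩
  · rintro ⟨g, rfl⟩ e
    exact congr_arg g (Quotient.sound ⟨-1, by simp⟩)

theorem sum_invariant_prod [DecidableEq κ] (τ : Equiv.Perm F)
    [Fintype (Cycles τ)] [DecidableEq (Cycles τ)] (l : κ → ℝ) :
    ∑ J : F → κ with ∀ e, J (τ e) = J e, ∏ e, l (J e) =
      ∏ c : Cycles τ, ∑ j, l j ^ (Finset.univ.filter fun e => cycleMk τ e = c).card := by
  have hinj : Function.Injective fun (g : Cycles τ → κ) e => g (cycleMk τ e) :=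
    Quotient.mk_surjective.injective_comp_right
  rw [filter_invariant_eq_image, Finset.sum_image hinj.injOn, Fintype.prod_sum]
  refine Finset.sum_congr rfl fun g _ => ?_
  rw [← Finset.prod_fiberwise (s := Finset.univ) (g := cycleMk τ)]
  refine Finset.prod_congr rfl fun c _ => Finset.prod_eq_pow_card fun e he => ?_
  exact congr_arg (fun c => l (g c)) (Finset.mem_filter.1 he).2

theorem sum_invariant_prod_le [DecidableEq κ] (hτ : ∀ e, τ e ≠ e) (l : κ → ℝ) :
    ∑ J : F → κ with ∀ e, J (τ e) = J e, ∏ e, l (J e) ≤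
      √(∑ j, l j ^ 2) ^ Fintype.card F := by
  classical
  have hcard (c : Cycles τ) : 2 ≤ (Finset.univ.filter fun e => cycleMk τ e = c).card := by
    induction c using Quotient.ind with
    | _ e =>
      have h : cycleMk τ (τ e) = cycleMk τ e := Quotient.sound ⟨-1, by simp⟩
      exact Finset.one_lt_card.2 ⟨e, by simp, τ e, by simp [h], (hτ e).symm⟩
  calc _ ≤ ∏ c : Cycles τ, |∑ j, l j ^ (Finset.univ.filter fun e => cycleMk τ e = c).card| := by
        rw [sum_invariant_prod, ← Finset.abs_prod]
        exact le_abs_self _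
    _ ≤ ∏ c : Cycles τ, √(∑ j, l j ^ 2) ^ (Finset.univ.filter fun e => cycleMk τ e = c).card :=
        Finset.prod_le_prod (fun _ _ => abs_nonneg _) fun c _ =>
          abs_sum_pow_le_sqrt_pow l (hcard c)
    _ = _ := by
        rw [Finset.prod_pow_eq_pow_sum, ← Finset.card_univ (α := F),
          Finset.card_eq_sum_card_fiberwise (f := cycleMk τ) (t := Finset.univ) (by simp)]

-- Expanding every factor in the eigenbasis, orthonormality leaves only the choices of eigenvectors
-- that are constant on the cycles of `τ`.
theorem sum_prod_symm_eq {K : κ → κ → ℝ} {ι : Type*} [Fintype ι] [DecidableEq ι]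
    {U : κ → ι → ℝ} {l : ι → ℝ} (hKU : ∀ x y, K x y = ∑ j, l j * (U x j * U y j))
    (hU : ∀ i j, ∑ x, U x i * U x j = if i = j then 1 else 0) :
    ∑ a : F → κ, ∏ e, K (a e) (a (τ e)) = ∑ J : F → ι with ∀ e, J (τ e) = J e, ∏ e, l (J e) :=
  calc ∑ a : F → κ, ∏ e, K (a e) (a (τ e))
      = ∑ J : F → ι, ∑ a : F → κ, ∏ e, (l (J e) * (U (a e) (J e) * U (a (τ e)) (J e))) := by
        simp_rw [hKU, Fintype.prod_sum]
        exact Finset.sum_comm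
    _ = ∑ J : F → ι, (∏ e, l (J e)) * ∑ a : F → κ, ∏ e, (U (a e) (J e) * U (a (τ e)) (J e)) := by
        refine Finset.sum_congr rfl fun J _ => ?_
        rw [Finset.mul_sum]
        exact Finset.sum_congr rfl fun a _ => Finset.prod_mul_distrib
    _ = ∑ J : F → ι, (∏ e, l (J e)) * ∏ e, ∑ x, U x (J e) * U x (J (τ⁻¹ e)) := by
        simp_rw [Fintype.prod_sum, Finset.prod_mul_distrib]
        refine Finset.sum_congr rfl fun J _ => ?_
        congr 1
        refine Finset.sum_congr rfl fun a _ => ?_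
        rw [← Equiv.prod_comp τ fun e => U (a e) (J (τ⁻¹ e))]
        simp
    _ = _ := by
        have hinv (J : F → ι) : (∀ e, J e = J (τ⁻¹ e)) ↔ ∀ e, J (τ e) = J e :=
          ⟨fun h e => by simpa using h (τ e), fun h e => by simpa using h (τ⁻¹ e)⟩
        simp_rw [hU, Finset.prod_ite_zero, Finset.prod_const_one, Finset.mem_univ, true_imp_iff,
          hinv, mul_ite, mul_one, mul_zero, Finset.sum_filter]

theorem sum_prod_symm_le (hτ : ∀ e, τ e ≠ e) {K : κ → κ → ℝ} (hK : ∀ x y, K x y = K y x) :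
    ∑ a : F → κ, ∏ e, K (a e) (a (τ e)) ≤ √(∑ x, ∑ y, K x y ^ 2) ^ Fintype.card F := by
  classical
  obtain ⟨U, l, hKU, hU⟩ := exists_spectral_decomposition hK
  rw [sum_sum_sq_eq_sum_sq hKU hU, sum_prod_symm_eq hKU hU]
  exact sum_invariant_prod_le hτ l

end CyclicProducts

section TransferMatrix

variable {F κ β : Type*} [Fintype F] {τ : Equiv.Perm F}

theorem measureReal_pi_singleton (ν : PMF β) [MeasurableSpace β] [MeasurableSingletonClass β]
    (w : F → β) : (Measure.pi fun _ : F => ν.toMeasure).real {w} = ∏ e, (ν (w e)).toReal := by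
  simp only [measureReal_def, Measure.pi_singleton, ENNReal.toReal_prod,
    PMF.toMeasure_apply_singleton _ _ (measurableSet_singleton _)]

theorem sum_toReal_eq_one [Fintype β] (ν : PMF β) :
    ∑ x, (ν x).toReal = 1 := by
  rw [← ENNReal.toReal_sum fun x _ => ν.apply_ne_top x,
    ← tsum_fintype (L := .unconditional _), ν.tsum_coe, ENNReal.toReal_one]

variable [DecidableEq F]

/-- The restriction of a permutation to the points that it moves. -/
abbrev movedPerm (τ : Equiv.Perm F) : Equiv.Perm {e // τ e ≠ e} :=
  τ.subtypePerm fun e => by simp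

theorem prod_ite_fixed_eq (τ : Equiv.Perm F) (μ : κ → ℝ) (T : κ → κ → ℝ) (a : F → κ) :
    ∏ e, (if τ e = e then μ (a e) else T (a e) (a (τ e))) =
      (∏ e : {e // τ e = e}, μ (a e)) * ∏ e : {e // τ e ≠ e}, T (a e) (a (movedPerm τ e)) := by
  rw [← Fintype.prod_subtype_mul_prod_subtype (fun e => τ e = e)]
  congr 1
  · exact Finset.prod_congr rfl fun e _ => if_pos e.2
  · exact Finset.prod_congr rfl fun e _ => if_neg e.2

variable [Fintype κ]

theorem sum_prod_reversible_le (hτ : ∀ e, τ e ≠ e) {T : κ → κ → ℝ} {c : κ → ℝ}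
    (hc : ∀ x, 0 < c x) (hT : ∀ x y, c x * T x y = c y * T y x) :
    ∑ a : F → κ, ∏ e, T (a e) (a (τ e)) ≤ √(∑ x, ∑ y, T x y * T y x) ^ Fintype.card F := by
  let K : κ → κ → ℝ := fun x y => √(c x) * T x y / √(c y)
  have hc' (x : κ) : √(c x) ≠ 0 := (Real.sqrt_pos.2 (hc x)).ne'
  have hsq (x : κ) : √(c x) * √(c x) = c x := Real.mul_self_sqrt (hc x).le
  have hsymm (x y : κ) : K x y = K y x := by
    rw [div_eq_div_iff (hc' y) (hc' x), mul_right_comm, hsq, hT, mul_right_comm, hsq]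
  have hK (x y : κ) : K x y ^ 2 = T x y * T y x := by
    rw [sq]
    nth_rw 2 [hsymm]
    simp only [K]
    field_simp [hc' x, hc' y]
  have hprod (a : F → κ) : ∏ e, K (a e) (a (τ e)) = ∏ e, T (a e) (a (τ e)) := by
    simp only [K, Finset.prod_div_distrib, Finset.prod_mul_distrib]
    rw [Equiv.prod_comp τ fun e => √(c (a e)),
      mul_div_cancel_left₀ _ (Finset.prod_ne_zero_iff.2 fun e _ => hc' _)]
  simpa only [hK, hprod] using sum_prod_symm_le hτ hsymm

theorem sum_prod_bool_le (hτ : ∀ e, τ e ≠ e) {T : Bool → Bool → ℝ} (hT : ∀ x y, 0 ≤ T x y) :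
    ∑ a : F → Bool, ∏ e, T (a e) (a (τ e)) ≤
      √(∑ x, ∑ y, T x y * T y x) ^ Fintype.card F := by
  -- A kernel on two states with positive entries is reversible.
  have hpos (ε : ℝ) (hε : 0 < ε) : ∑ a : F → Bool, ∏ e, (T (a e) (a (τ e)) + ε) ≤
      √(∑ x, ∑ y, (T x y + ε) * (T y x + ε)) ^ Fintype.card F := by
    refine sum_prod_reversible_le hτ (T := fun x y => T x y + ε) (c := fun x => T (!x) x + ε)
      (fun x => add_pos_of_nonneg_of_pos (hT _ _) hε) fun x y => ?_
    cases x <;> cases y <;> simp only [Bool.not_true, Bool.not_false, mul_comm]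
  have hl : Continuous fun ε : ℝ => ∑ a : F → Bool, ∏ e, (T (a e) (a (τ e)) + ε) := by fun_prop
  have hr : Continuous fun ε : ℝ => √(∑ x, ∑ y, (T x y + ε) * (T y x + ε)) ^ Fintype.card F := by
    fun_prop
  refine le_of_tendsto_of_tendsto (b := 𝓝[>] (0 : ℝ))
    ((hl.tendsto' 0 _ ?_).mono_left nhdsWithin_le_nhds)
    ((hr.tendsto' 0 _ ?_).mono_left nhdsWithin_le_nhds)
    (eventually_mem_nhdsWithin.mono fun ε hε => hpos ε hε) <;> simp

theorem sum_prod_ite_fixed_eq (τ : Equiv.Perm F) {μ : κ → ℝ} (hμ : ∑ x, μ x = 1)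
    (T : κ → κ → ℝ) :
    ∑ a : F → κ, ∏ e, (if τ e = e then μ (a e) else T (a e) (a (τ e))) =
      ∑ a : {e // τ e ≠ e} → κ, ∏ e, T (a e) (a (movedPerm τ e)) := by
  simp only [prod_ite_fixed_eq]
  refine (Equiv.sum_comp (Equiv.piEquivPiSubtypeProd (fun e => τ e = e) fun _ => κ)
    fun w => (∏ e, μ (w.1 e)) * ∏ e, T (w.2 e) (w.2 (movedPerm τ e))).trans ?_
  rw [Fintype.sum_prod_type]
  simp only
  rw [← Fintype.sum_mul_sum, ← Fintype.prod_sum, hμ, Finset.prod_const_one, one_mul]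

/-- The transfer matrix of the coupling `g` of a coordinate `x` with the coordinate `x'` that
follows it on its cycle, averaged over the second coordinate `y` under the law `ν`. -/
noncomputable def transferMatrix [Fintype β] (ν : PMF (κ × β)) (g : κ → κ → β → ℝ) (x x' : κ) : ℝ :=
  ∑ y, (ν (x, y)).toReal * g x x' y

variable [Fintype β] [MeasurableSpace κ] [MeasurableSpace β] [MeasurableSingletonClass κ]
  [MeasurableSingletonClass β]

theorem integral_prod_ite_fixed_eq (τ : Equiv.Perm F) (ν : PMF (κ × β)) (g : κ → κ → β → ℝ) :
    ∫ w, ∏ e, (if τ e = e then 1 else g (w e).1 (w (τ e)).1 (w e).2)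
        ∂Measure.pi (fun _ : F => ν.toMeasure) =
      ∑ a : {e // τ e ≠ e} → κ, ∏ e, transferMatrix ν g (a e) (a (movedPerm τ e)) := by
  have hmass : ∑ x, ∑ y, (ν (x, y)).toReal = 1 := by
    rw [← Fintype.sum_prod_type', sum_toReal_eq_one]
  have hfactor (a : F → κ) (e : F) :
      (if τ e = e then ∑ y, (ν (a e, y)).toReal else transferMatrix ν g (a e) (a (τ e))) =
        ∑ y, (ν (a e, y)).toReal * if τ e = e then 1 else g (a e) (a (τ e)) y := by
    split_ifs <;> simp [transferMatrix]
  rw [integral_fintype (Integrable.of_finite), ← sum_prod_ite_fixed_eq τ hmass,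
    ← (Equiv.arrowProdEquivProdArrow F (fun _ => κ) fun _ => β).symm.sum_comp,
    Fintype.sum_prod_type]
  simp only [hfactor, Fintype.prod_sum, measureReal_pi_singleton, smul_eq_mul,
    Finset.prod_mul_distrib]
  rfl

theorem integral_prod_ite_fixed_le (τ : Equiv.Perm F) (ν : PMF (Bool × β))
    {g : Bool → Bool → β → ℝ} (hg : ∀ x x' y, 0 ≤ g x x' y) :
    ∫ w, ∏ e, (if τ e = e then 1 else g (w e).1 (w (τ e)).1 (w e).2)
        ∂Measure.pi (fun _ : F => ν.toMeasure) ≤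
      √(∑ x, ∑ x', transferMatrix ν g x x' * transferMatrix ν g x' x) ^
        τ.support.card := by
  rw [integral_prod_ite_fixed_eq, Equiv.Perm.support, ← Fintype.card_subtype]
  exact sum_prod_bool_le (fun e he => e.2 (congr_arg Subtype.val he)) fun x x' =>
    Finset.sum_nonneg fun y _ => mul_nonneg ENNReal.toReal_nonneg (hg x x' y)

end TransferMatrix

/-! ## Exponential tail bounds for overlaps -/

section TailBounds

theorem toReal_thin (s : I) (b x : Bool) :
    (thin s b x).toReal = if b then (if x then (s : ℝ) else 1 - s) else if x then 0 else 1 := by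
  cases b
  · cases x
    · simp [thin_false_false]
    · simp [thin]
  · cases x <;> simp [thin, Measure.toPMF_apply, ProbabilityTheory.bernoulliMeasure_def]

theorem toReal_edgePairLaw (p s : I) (x y : Bool) :
    (edgePairLaw p s (x, y)).toReal =
      if x && y then (p * s ^ 2 : ℝ) else if x || y then p * s * (1 - s)
        else 1 - 2 * p * s + p * s ^ 2 := by
  rw [edgePairLaw_apply, ENNReal.toReal_sum fun z _ =>
    ENNReal.mul_ne_top (PMF.apply_ne_top _ _)
      (ENNReal.mul_ne_top (PMF.apply_ne_top _ _) (PMF.apply_ne_top _ _))]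
  simp only [ENNReal.toReal_mul, toReal_thin, Fintype.sum_bool]
  cases x <;> cases y <;>
    simp only [Bool.and_true, Bool.and_false, Bool.or_true, Bool.or_false, Bool.false_eq_true,
      if_true, if_false] <;> ring

theorem transferMatrix_true (p s : I) (g : Bool → Bool → Bool → ℝ) (x' : Bool) :
    transferMatrix (edgePairLaw p s) g true x' =
      p * s ^ 2 * g true x' true + p * s * (1 - s) * g true x' false := by
  simp [transferMatrix, toReal_edgePairLaw]

theorem transferMatrix_false (p s : I) (g : Bool → Bool → Bool → ℝ) (x' : Bool) :
    transferMatrix (edgePairLaw p s) g false x' =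
      p * s * (1 - s) * g false x' true + (1 - 2 * p * s + p * s ^ 2) * g false x' false := by
  simp [transferMatrix, toReal_edgePairLaw]

variable {F : Type*} [Fintype F]

theorem measureReal_le_integral_of_one_le {Ω : Type*} [MeasurableSpace Ω]
    [Finite Ω] [MeasurableSingletonClass Ω] {μ : Measure Ω} [IsFiniteMeasure μ] {f : Ω → ℝ}
    (hf : ∀ w, 0 ≤ f w) {E : Set Ω} (hE : ∀ w ∈ E, 1 ≤ f w) : μ.real E ≤ ∫ w, f w ∂μ := by
  rw [← integral_indicator_one E.toFinite.measurableSet]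
  refine integral_mono Integrable.of_finite Integrable.of_finite fun w => ?_
  exact Set.indicator_le' hE (fun w _ => hf w) w

theorem sqrt_le_exp {x d : ℝ} (h : x ≤ 1 + 2 * d) : √x ≤ Real.exp d := by
  rw [Real.sqrt_le_left (Real.exp_pos d).le, ← Real.exp_nat_mul]
  push_cast
  linarith [Real.add_one_le_exp (2 * d)]

theorem integral_edgePairLaw_exp_common_le (p s : I) :
    ∫ x, (if x.1 ∧ x.2 then Real.exp (-1) else 1) ∂(edgePairLaw p s).toMeasure ≤
      Real.exp (-(p * s ^ 2 / 2)) := by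
  have hq : Real.exp (-1) ≤ 1 / 2 := by linarith [Real.exp_neg_one_lt_d9]
  have hps : 0 ≤ (p * s ^ 2 : ℝ) := mul_nonneg p.2.1 (sq_nonneg _)
  calc _ = 1 - p * s ^ 2 * (1 - Real.exp (-1)) := by
        rw [integral_fintype Integrable.of_finite]
        simp only [measureReal_def, PMF.toMeasure_apply_fintype, Set.indicator_singleton,
          Finset.sum_pi_single', Finset.mem_univ, ↓reduceIte, smul_eq_mul, mul_ite, mul_one,
          Fintype.sum_prod_type, Fintype.univ_bool, toReal_edgePairLaw, Bool.and_eq_true,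
          Bool.or_eq_true, ite_mul, Finset.mem_singleton, Bool.true_eq_false, not_false_eq_true,
          Finset.sum_insert, and_true, or_true, Finset.sum_singleton, Bool.false_eq_true,
          and_false, or_false]
        ring
    _ ≤ -(p * s ^ 2 / 2) + 1 := by nlinarith
    _ ≤ _ := Real.add_one_le_exp _

theorem measureReal_card_common_le (J : Finset F) (p s : I) (t : ℝ) :
    (configLaw F p s).real {w | ((J.filter fun e => (w e).1 ∧ (w e).2).card : ℝ) ≤ t} ≤
      Real.exp (t - p * s ^ 2 / 2 * J.card) := by
  classical
  let f : F → Bool × Bool → ℝ := fun e x => if e ∈ J ∧ x.1 ∧ x.2 then Real.exp (-1) else 1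
  have hf0 (e x) : 0 ≤ f e x := by simp only [f]; positivity
  have hprod (w : F → Bool × Bool) :
      ∏ e, f e (w e) = Real.exp (-1) ^ (J.filter fun e => (w e).1 ∧ (w e).2).card := by
    rw [← Finset.prod_filter, Finset.prod_const, ← Finset.filter_filter, Finset.filter_univ_mem]
  have hfactor (e : F) : ∫ x, f e x ∂(edgePairLaw p s).toMeasure ≤
      if e ∈ J then Real.exp (-(p * s ^ 2 / 2)) else 1 := by
    by_cases he : e ∈ J
    · simpa only [f, he, true_and, if_true] using integral_edgePairLaw_exp_common_le p s
    · simp [f, he]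
  calc _ ≤ ∫ w, (∏ e, f e (w e)) * Real.exp t ∂configLaw F p s := by
        refine measureReal_le_integral_of_one_le (fun w => ?_) fun w hw => ?_ <;>
          rw [hprod]
        · positivity
        · rw [← Real.exp_nat_mul, ← Real.exp_add]
          exact Real.one_le_exp (by linarith [hw.out])
    _ = (∏ e, ∫ x, f e x ∂(edgePairLaw p s).toMeasure) * Real.exp t := by
        rw [integral_mul_const, integral_fintype_prod_eq_prod]
    _ ≤ (∏ e, if e ∈ J then Real.exp (-(p * s ^ 2 / 2)) else 1) * Real.exp t :=
        mul_le_mul_of_nonneg_right (Finset.prod_le_prod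
          (fun e _ => integral_nonneg (hf0 e)) fun e _ => hfactor e) (Real.exp_pos _).le
    _ = _ := by
        rw [Finset.prod_ite_mem, Finset.univ_inter, Finset.prod_const, ← Real.exp_nat_mul,
          ← Real.exp_add]
        congr 1
        ring

/-- The exponential rate, per moved pair of vertices, at which the identity is preferred to a
given permutation. -/
noncomputable def separationRate (p s : ℝ) : ℝ := p * s ^ 2 * (1 - p * s) * (1 - √p) ^ 2

theorem prod_ite_and_eq_pow_overlap (τ : Equiv.Perm F) (w : F → Bool × Bool) (z : ℝ) :
    ∏ e, (if (w (τ e)).1 ∧ (w e).2 then z else 1) = z ^ overlap τ w := by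
  rw [← Finset.prod_filter, Finset.prod_const, overlap]

theorem transfer_sum_le_one_sub_separationRate {z s : ℝ} (hz0 : 0 ≤ z) (hz1 : z ≤ 1)
    (hs0 : 0 ≤ s) (hs1 : s ≤ 1) :
    (z ^ 2 * s) ^ 2 + (1 - z ^ 2 * s) ^ 2 + 2 * (((1 - z ^ 2 * s) + z * s * (1 - s) * (1 - z)) *
      (z ^ 2 * s * (1 - s * (1 - z)))) ≤
      1 - 2 * (z ^ 2 * s ^ 2 * (1 - z ^ 2 * s) * (1 - z) ^ 2) := by
  have _ : 0 ≤ 1 - z := by linarith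
  have hz2 : z ^ 2 ≤ 1 := pow_le_one₀ hz0 hz1
  have hps : 0 ≤ 1 - z ^ 2 * s := by nlinarith
  have hsz : 0 ≤ 1 - s * (1 - z) := by nlinarith
  have hzs : 0 ≤ z * s * (1 - z) := by positivity
  have hfactor : (1 - z ^ 2 * s) + z * s * (1 - s) * (1 - z) ≤
      (1 - z ^ 2 * s) * (1 + z * s * (1 - z)) := by
    nlinarith [mul_nonneg hzs (mul_nonneg hs0 (sub_nonneg.2 hz2))]
  have hcube : (1 + z * s * (1 - z)) * (1 - s * (1 - z)) ≤ 1 - s * (1 - z) ^ 2 := by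
    nlinarith [mul_nonneg hz0 (sq_nonneg (s * (1 - z)))]
  have hcross : ((1 - z ^ 2 * s) + z * s * (1 - s) * (1 - z)) * (z ^ 2 * s * (1 - s * (1 - z))) ≤
      z ^ 2 * s * (1 - z ^ 2 * s) * (1 - s * (1 - z) ^ 2) :=
    calc _ ≤ (1 - z ^ 2 * s) * (1 + z * s * (1 - z)) * (z ^ 2 * s * (1 - s * (1 - z))) := by
          gcongr
      _ = z ^ 2 * s * (1 - z ^ 2 * s) * ((1 + z * s * (1 - z)) * (1 - s * (1 - z))) := by ring
      _ ≤ _ := by gcongr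
  nlinarith

variable [DecidableEq F]

/-- The coupling whose product over the moved points is `z` to the power
`overlap 1 w - overlap τ w`. -/
noncomputable def tiltCoupling (z : ℝ) (x x' y : Bool) : ℝ :=
  (if x ∧ y then z else 1) * (if x' ∧ y then z⁻¹ else 1)

theorem prod_tiltCoupling_eq (τ : Equiv.Perm F) (w : F → Bool × Bool) {z : ℝ} (hz : z ≠ 0) :
    ∏ e, (if τ e = e then 1 else tiltCoupling z (w e).1 (w (τ e)).1 (w e).2) =
      z ^ overlap 1 w * z⁻¹ ^ overlap τ w := by
  rw [← prod_ite_and_eq_pow_overlap, ← prod_ite_and_eq_pow_overlap, ← Finset.prod_mul_distrib]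
  refine Finset.prod_congr rfl fun e _ => ?_
  by_cases h : τ e = e
  · rw [if_pos h, h]
    change 1 = tiltCoupling z (w e).1 (w e).1 (w e).2
    unfold tiltCoupling
    split_ifs <;> simp [hz]
  · exact if_neg h

theorem transferMatrix_tiltCoupling_le {p s : I} (hp : (p : ℝ) ≠ 0) :
    ∑ x, ∑ x', transferMatrix (edgePairLaw p s) (tiltCoupling √p) x x' *
      transferMatrix (edgePairLaw p s) (tiltCoupling √p) x' x ≤ 1 + 2 * -separationRate p s := by
  have hz : √(p : ℝ) ≠ 0 := by rwa [Ne, Real.sqrt_eq_zero p.2.1]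
  have hzp : √(p : ℝ) ^ 2 = p := Real.sq_sqrt p.2.1
  have hle := transfer_sum_le_one_sub_separationRate (Real.sqrt_nonneg p)
    (Real.sqrt_le_one.2 p.2.2) s.2.1 s.2.2
  have h11 : transferMatrix (edgePairLaw p s) (tiltCoupling √p) true true = p * s := by
    simp only [transferMatrix_true, tiltCoupling, reduceIte, true_and, Bool.false_eq_true,
      mul_inv_cancel₀ hz]
    ring
  have h10 : transferMatrix (edgePairLaw p s) (tiltCoupling √p) true false =
      p * s * (1 - s * (1 - √p)) := by
    simp only [transferMatrix_true, tiltCoupling, reduceIte, true_and, false_and,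
      Bool.false_eq_true]
    ring
  have h00 : transferMatrix (edgePairLaw p s) (tiltCoupling √p) false false = 1 - p * s := by
    simp only [transferMatrix_false, tiltCoupling, reduceIte, false_and, Bool.false_eq_true]
    ring
  have h01 : transferMatrix (edgePairLaw p s) (tiltCoupling √p) false true =
      (1 - p * s) + √p * s * (1 - s) * (1 - √p) := by
    have hinv : (p : ℝ) * (√p)⁻¹ = √p := by
      nth_rw 1 [← hzp]
      field_simp
    simp only [transferMatrix_false, tiltCoupling, reduceIte, true_and, false_and,
      Bool.false_eq_true]
    linear_combination (s * (1 - s) : ℝ) * hinv + (s * (1 - s) : ℝ) * hzp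
  rw [hzp] at hle
  simp only [Fintype.sum_bool, h11, h10, h00, h01, separationRate]
  linarith

theorem separationRate_nonneg (p s : I) : 0 ≤ separationRate p s := by
  have hps : 0 ≤ 1 - (p : ℝ) * s := sub_nonneg.2 (mul_le_one₀ p.2.2 s.2.1 s.2.2)
  have hp := p.2.1
  unfold separationRate
  positivity

theorem measureReal_overlap_one_le_overlap_le (τ : Equiv.Perm F) (p s : I) :
    (configLaw F p s).real {w | overlap 1 w ≤ overlap τ w} ≤
      Real.exp (-(separationRate p s * τ.support.card)) := by
  rcases eq_or_ne (p : ℝ) 0 with hp | hp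
  · simp [separationRate, hp]
  have hz0 : 0 < √(p : ℝ) := Real.sqrt_pos.2 (p.2.1.lt_of_ne' hp)
  have hz1 : √(p : ℝ) ≤ 1 := Real.sqrt_le_one.2 p.2.2
  have hg (x x' y : Bool) : 0 ≤ tiltCoupling √p x x' y := by unfold tiltCoupling; positivity
  calc _ ≤ ∫ w, ∏ e, (if τ e = e then 1 else tiltCoupling √p (w e).1 (w (τ e)).1 (w e).2)
          ∂configLaw F p s := by
        refine measureReal_le_integral_of_one_le (fun w => ?_) fun w hw => ?_ <;>
          rw [prod_tiltCoupling_eq τ w hz0.ne']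
        · positivity
        · rw [inv_pow, ← div_eq_mul_inv, one_le_div (by positivity)]
          exact pow_le_pow_of_le_one hz0.le hz1 hw
    _ ≤ _ := integral_prod_ite_fixed_le τ _ hg
    _ ≤ Real.exp (-separationRate p s) ^ τ.support.card := by
        gcongr
        exact sqrt_le_exp (transferMatrix_tiltCoupling_le hp)
    _ = _ := by
        rw [← Real.exp_nat_mul]
        congr 1
        ring

/-- The overlap restricted to the points moved by `τ`. -/
def movedOverlap (τ : Equiv.Perm F) (w : F → Bool × Bool) : ℕ :=
  (τ.support.filter fun e => (w (τ e)).1 ∧ (w e).2).card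

theorem prod_ite_eq_pow_movedOverlap (τ : Equiv.Perm F) (w : F → Bool × Bool) (z : ℝ) :
    ∏ e, (if τ e = e then 1 else if (w (τ e)).1 ∧ (w e).2 then z else 1) =
      z ^ movedOverlap τ w := by
  rw [movedOverlap, ← Finset.prod_const, Finset.prod_filter, Equiv.Perm.support,
    Finset.prod_filter]
  refine Finset.prod_congr rfl fun e _ => ?_
  by_cases h : τ e = e <;> simp [h]

theorem transfer_sum_le_one_add {p s L : ℝ} (hp0 : 0 ≤ p) (hs0 : 0 ≤ s)
    (hs1 : s ≤ 1) (hL : 1 ≤ L) :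
    (p * s * (1 - s + s * L)) ^ 2 + (1 - p * s) ^ 2 +
      2 * (((1 - p * s) + p * s * (1 - s) * (L - 1)) * (p * s)) ≤ 1 + 2 * (2 * (p * L) ^ 2) := by
  have hps : p * s ≤ p := mul_le_of_le_one_right hp0 hs1
  have _ : 0 ≤ 1 - s := by linarith
  have hL1 : 0 ≤ L - 1 := by linarith
  have hdiag : (p * s * (1 - s + s * L)) ^ 2 ≤ (p * L) ^ 2 := by
    gcongr
    nlinarith
  have hfactor : p * s * (1 - s) * (L - 1) ≤ p * L ^ 2 := by
    have : p * s * (1 - s) ≤ p := by nlinarith [mul_nonneg hp0 hs0]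
    exact mul_le_mul this (by nlinarith) hL1 hp0
  have hcross : p * s * (1 - s) * (L - 1) * (p * s) ≤ (p * L) ^ 2 :=
    calc _ ≤ p * L ^ 2 * p := by gcongr
      _ = _ := by ring
  nlinarith [sq_nonneg (p * L), sq_nonneg (p * s)]

theorem measureReal_le_movedOverlap_le (τ : Equiv.Perm F) (p s : I) {c : ℝ} (hc : 0 ≤ c)
    (t : ℝ) :
    (configLaw F p s).real {w | t ≤ movedOverlap τ w} ≤
      Real.exp (2 * (p * Real.exp c) ^ 2 * τ.support.card - c * t) := by
  set L := Real.exp c with hL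
  let g : Bool → Bool → Bool → ℝ := fun _ x' y => if x' ∧ y then L else 1
  have hg (x x' y : Bool) : 0 ≤ g x x' y := by simp only [g]; positivity
  have htransfer : ∑ x, ∑ x', transferMatrix (edgePairLaw p s) g x x' *
      transferMatrix (edgePairLaw p s) g x' x ≤ 1 + 2 * (2 * (p * L) ^ 2) := by
    refine le_trans (le_of_eq ?_) (transfer_sum_le_one_add p.2.1 s.2.1 s.2.2
      (Real.one_le_exp hc))
    simp only [Fintype.sum_bool, transferMatrix_true, transferMatrix_false, g, reduceIte,
      and_true, and_false, Bool.false_eq_true]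
    ring
  calc _ ≤ ∫ w, (∏ e, (if τ e = e then 1 else g (w e).1 (w (τ e)).1 (w e).2)) *
          Real.exp (-(c * t)) ∂configLaw F p s := by
        refine measureReal_le_integral_of_one_le (fun w => ?_) fun w hw => ?_ <;>
          rw [prod_ite_eq_pow_movedOverlap τ w]
        · positivity
        · rw [hL, ← Real.exp_nat_mul, ← Real.exp_add]
          exact Real.one_le_exp (by linarith [mul_le_mul_of_nonneg_left hw.out hc])
    _ = (∫ w, ∏ e, (if τ e = e then 1 else g (w e).1 (w (τ e)).1 (w e).2) ∂configLaw F p s) *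
          Real.exp (-(c * t)) := integral_mul_const _ _
    _ ≤ √(∑ x, ∑ x', transferMatrix (edgePairLaw p s) g x x' *
          transferMatrix (edgePairLaw p s) g x' x) ^ τ.support.card *
          Real.exp (-(c * t)) := by
        gcongr
        exact integral_prod_ite_fixed_le τ _ hg
    _ ≤ Real.exp (2 * (p * L) ^ 2) ^ τ.support.card *
          Real.exp (-(c * t)) := by
        gcongr
        exact sqrt_le_exp htransfer
    _ = _ := by
        rw [← Real.exp_nat_mul, ← Real.exp_add]
        congr 1
        ring

end TailBounds

/-! ## Counting pairs and permutations -/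

section Counting

variable {V : Type*} [Fintype V]

theorem choose_le_exp_mul_div_pow {k : ℕ} (hk : 1 ≤ k) (n : ℕ) :
    (n.choose k : ℝ) ≤ (Real.exp 1 * (n / k)) ^ k := by
  have hfact : (k : ℝ) ^ k ≤ Real.exp k * k.factorial :=
    (div_le_iff₀ (by positivity)).1 (Real.pow_div_factorial_le_exp (k : ℝ) k.cast_nonneg k)
  refine (Nat.choose_le_pow_div k n).trans ?_
  rw [mul_pow, ← Real.exp_nat_mul, mul_one, div_pow, div_le_iff₀ (by positivity)]
  calc (n : ℝ) ^ k = (k : ℝ) ^ k * ((n : ℝ) ^ k / k ^ k) := by field_simp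
    _ ≤ (Real.exp k * k.factorial) * ((n : ℝ) ^ k / k ^ k) := by gcongr
    _ = _ := by ring

theorem sum_range_pow_succ_le {y : ℝ} (hy0 : 0 ≤ y) (hy : y ≤ 1 / 2) (m : ℕ) :
    ∑ k ∈ Finset.range m, y ^ (k + 1) ≤ 2 * y := by
  have hgeom : ∑ k ∈ Finset.range m, y ^ k ≤ 2 := by
    have := mul_neg_geom_sum y m
    have : 0 ≤ y ^ m := by positivity
    have : 0 ≤ ∑ k ∈ Finset.range m, y ^ k := Finset.sum_nonneg fun _ _ => by positivity
    nlinarith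
  simp_rw [pow_succ, ← Finset.sum_mul]
  gcongr

theorem sum_nonempty_card_le {f : ℕ → ℝ} {y : ℝ} (hy0 : 0 ≤ y) (hy : y ≤ 1 / 2)
    (hf : ∀ k, 1 ≤ k → ((Fintype.card V).choose k : ℝ) * f k ≤ y ^ k) :
    ∑ S : Finset V with S.Nonempty, f S.card ≤ 2 * y := by
  have h := Finset.sum_powerset_apply_card (fun k => if k = 0 then 0 else f k)
    (x := (Finset.univ : Finset V))
  rw [Finset.powerset_univ, Finset.card_univ] at h
  calc _ = ∑ S : Finset V, if S.card = 0 then 0 else f S.card := by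
        rw [Finset.sum_filter]
        refine Finset.sum_congr rfl fun S _ => ?_
        by_cases hS : S = ∅ <;> simp [hS, Finset.nonempty_iff_ne_empty]
    _ = ∑ k ∈ Finset.range (Fintype.card V), ((Fintype.card V).choose (k + 1) : ℝ) * f (k + 1) := by
        rw [h, Finset.sum_range_succ']
        simp
    _ ≤ ∑ k ∈ Finset.range (Fintype.card V), y ^ (k + 1) :=
        Finset.sum_le_sum fun k _ => hf _ k.succ_pos
    _ ≤ 2 * y := sum_range_pow_succ_le hy0 hy _

variable [DecidableEq V]

/-- The pairs of vertices that meet `S`. -/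
def incidentPairs (S : Finset V) : Finset (Pairs V) :=
  Finset.univ.filter fun e => ∃ i ∈ S, i ∈ e.1

theorem mem_support_pairPerm {τ : Equiv.Perm V} {e : Pairs V} :
    e ∈ (pairPerm τ).support ↔ e.1.map τ ≠ e.1 := by
  rw [Equiv.Perm.mem_support, Ne, Subtype.ext_iff, coe_pairPerm]

theorem card_support_mul_sub_le_card_support_pairPerm (τ : Equiv.Perm V) :
    (τ.support.card : ℝ) * (Fintype.card V - τ.support.card) ≤ (pairPerm τ).support.card := by
  have hcard : ((τ.support ×ˢ τ.supportᶜ).card : ℝ) =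
      τ.support.card * (Fintype.card V - τ.support.card) := by
    rw [Finset.card_product, Finset.card_compl, Nat.cast_mul,
      Nat.cast_sub τ.support.card_le_univ]
  rw [← hcard, ← Finset.card_map (Function.Embedding.subtype _), Nat.cast_le]
  refine Finset.card_le_card_of_injOn (fun z => s(z.1, z.2)) ?_ ?_
  · rintro ⟨i, j⟩ hij
    simp only [Finset.coe_product, Set.mem_prod, Finset.mem_coe, Finset.mem_compl,
      Equiv.Perm.mem_support, not_not] at hij
    have hne : i ≠ j := fun h => hij.1 (h ▸ hij.2)
    refine Finset.mem_map.2 ⟨⟨s(i, j), by simpa using hne⟩, mem_support_pairPerm.2 ?_, rfl⟩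
    simp only [Sym2.map_mk, ne_eq, Sym2.eq_iff, not_or, hij.2]
    exact ⟨fun h => hij.1 h.1, fun h => hne h.2.symm⟩
  · rintro ⟨i, j⟩ hij ⟨i', j'⟩ hij' h
    simp only [Finset.coe_product, Set.mem_prod, Finset.mem_coe, Finset.mem_compl] at hij hij'
    rcases Sym2.eq_iff.1 h with ⟨rfl, rfl⟩ | ⟨rfl, rfl⟩
    · rfl
    · exact absurd hij.1 hij'.2

theorem card_support_pairPerm_le (τ : Equiv.Perm V) :
    (pairPerm τ).support.card ≤ τ.support.card * Fintype.card V := by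
  rw [← Finset.card_univ, ← Finset.card_product, ← Finset.card_map (Function.Embedding.subtype _)]
  refine le_trans (Finset.card_le_card fun e he => ?_)
    (Finset.card_image_le (f := fun z : V × V => s(z.1, z.2)))
  obtain ⟨⟨e, hd⟩, hmoved, rfl⟩ := Finset.mem_map.1 he
  rw [mem_support_pairPerm] at hmoved
  induction e using Sym2.ind with
  | _ i j =>
  simp only [Function.Embedding.subtype_apply, Finset.mem_image, Finset.mem_product,
    Finset.mem_univ, and_true, Prod.exists, Equiv.Perm.mem_support]
  by_cases hi : τ i = i
  · exact ⟨j, i, fun hj => hmoved (by simp [hi, hj]), Sym2.eq_swap⟩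
  · exact ⟨i, j, hi, rfl⟩

-- A pair incident to the support of `τ` that `τ` fixes is of the form `{i, τ i}`.
theorem card_filter_incidentPairs_le (τ : Equiv.Perm V) (P : Pairs V → Prop) [DecidablePred P] :
    ((incidentPairs τ.support).filter P).card ≤
      ((pairPerm τ).support.filter P).card + τ.support.card := by
  rw [← Finset.card_map (Function.Embedding.subtype _),
    ← Finset.card_map (s := (pairPerm τ).support.filter P) (Function.Embedding.subtype _)]
  refine le_trans (Finset.card_le_card fun e he => ?_) ((Finset.card_union_le _ _).trans
    (Nat.add_le_add_left (Finset.card_image_le (f := fun i => s(i, τ i))) _))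
  simp only [Finset.mem_map, Finset.mem_filter, incidentPairs, Finset.mem_univ, true_and,
    Function.Embedding.subtype_apply] at he
  obtain ⟨e, ⟨⟨i, hi, hie⟩, hP⟩, rfl⟩ := he
  rw [Finset.mem_union]
  by_cases hm : e ∈ (pairPerm τ).support
  · exact Or.inl (Finset.mem_map.2 ⟨e, Finset.mem_filter.2 ⟨hm, hP⟩, rfl⟩)
  · obtain ⟨j, hj⟩ := Sym2.mem_iff_exists.1 hie
    rw [mem_support_pairPerm, not_not, hj, Sym2.map_mk, Sym2.eq_iff] at hm
    refine Or.inr (Finset.mem_image.2 ⟨i, hi, ?_⟩)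
    rcases hm with hm | hm
    · exact absurd hm.1 (Equiv.Perm.mem_support.1 hi)
    · rw [hj, hm.1]

theorem card_mul_le_two_mul_card_incidentPairs (S : Finset V) :
    (S.card : ℝ) * (Fintype.card V - 1) ≤ 2 * (incidentPairs S).card := by
  let h : Sym2 V → ℝ := fun e => if ¬ e.IsDiag ∧ ∃ i ∈ S, i ∈ e then 1 else 0
  have h0 (e) : 0 ≤ h e := by simp only [h]; positivity
  have hcard : ((incidentPairs S).card : ℝ) = ∑ e : Pairs V, h e.1 := by
    simp only [h]
    rw [Finset.sum_boole, incidentPairs]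
    congr 2
    ext e
    simp [e.2]
  rw [hcard, ← sum_sum_sym2 fun e he => by simp [h, he]]
  calc _ = ∑ i ∈ S, ∑ _ ∈ Finset.univ.erase i, (1 : ℝ) := by
        simp only [Finset.sum_erase_eq_sub (Finset.mem_univ _), Finset.sum_const, nsmul_eq_mul,
          Finset.card_univ, mul_one]
    _ ≤ ∑ i ∈ S, ∑ j, h s(i, j) := by
        refine Finset.sum_le_sum fun i hi => (Finset.sum_le_sum fun j hj => ?_).trans
          (Finset.sum_le_sum_of_subset_of_nonneg (Finset.erase_subset i _) fun _ _ _ => h0 _)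
        have hij : h s(i, j) = 1 :=
          if_pos ⟨(Finset.ne_of_mem_erase hj).symm, i, hi, Sym2.mem_mk_left _ _⟩
        exact hij.ge
    _ ≤ _ := Finset.sum_le_sum_of_subset_of_nonneg (Finset.subset_univ _) fun i _ _ =>
        Finset.sum_nonneg fun _ _ => h0 _

theorem card_support_mul_le_two_mul_card_support_pairPerm (τ : Equiv.Perm V) :
    (τ.support.card : ℝ) * (Fintype.card V - 3) ≤ 2 * (pairPerm τ).support.card := by
  have hpairs : ((incidentPairs τ.support).card : ℝ) ≤
      (pairPerm τ).support.card + τ.support.card := by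
    exact_mod_cast by simpa using card_filter_incidentPairs_le τ fun _ => True
  linarith [card_mul_le_two_mul_card_incidentPairs τ.support]

theorem card_filter_support_eq_le (S : Finset V) :
    (Finset.univ.filter fun τ : Equiv.Perm V => τ.support = S).card ≤ S.card.factorial := by
  have h := Fintype.card_congr (Equiv.Perm.subtypeEquivSubtypePerm fun i => i ∈ S)
  rw [Fintype.card_perm, Fintype.card_coe, Fintype.card_subtype] at h
  rw [h]
  refine Finset.card_le_card (Finset.monotone_filter_right _ fun τ _ hτ i hi => ?_)
  rwa [← hτ, Equiv.Perm.mem_support, not_not] at hi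

theorem sum_ne_one_pow_card_support_le {x : ℝ} (hx0 : 0 ≤ x) (hx : Fintype.card V * x ≤ 1 / 2) :
    ∑ τ : Equiv.Perm V with τ ≠ 1, x ^ τ.support.card ≤ 2 * (Fintype.card V * x) := by
  calc _ = ∑ S : Finset V with S.Nonempty, ∑ τ ∈ (Finset.univ.filter fun τ : Equiv.Perm V =>
        τ ≠ 1).filter (fun τ => τ.support = S), x ^ τ.support.card := by
        refine (Finset.sum_fiberwise_of_maps_to (fun τ hτ => ?_) _).symm
        simpa [Finset.nonempty_iff_ne_empty] using hτ
    _ ≤ ∑ S : Finset V with S.Nonempty, (S.card.factorial : ℝ) * x ^ S.card := by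
        refine Finset.sum_le_sum fun S _ => ?_
        rw [Finset.sum_congr rfl fun τ hτ => by rw [(Finset.mem_filter.1 hτ).2],
          Finset.sum_const, nsmul_eq_mul]
        gcongr
        exact (Finset.card_le_card (Finset.filter_subset_filter _ (Finset.filter_subset _ _))).trans
          (card_filter_support_eq_le S)
    _ ≤ _ := by
        refine sum_nonempty_card_le (f := fun k => (k.factorial : ℝ) * x ^ k) (by positivity) hx
          fun k _ => ?_
        rw [mul_pow, ← mul_assoc, mul_comm (Nat.cast _)]
        gcongr
        exact_mod_cast (Nat.descFactorial_eq_factorial_mul_choose _ k).symm.le.trans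
          (Nat.descFactorial_le_pow _ k)

end Counting

section UnionBounds

variable {V Ω : Type*} [Fintype V] [MeasurableSpace Ω] {μ : Measure Ω}
  [IsProbabilityMeasure μ]

theorem measureReal_exists_large_finset_le {E : Finset V → Set Ω} {l w : ℝ} (hl : 0 ≤ l)
    (hE : ∀ S, Fintype.card V < l * S.card → μ.real (E S) ≤ Real.exp (-(w * S.card))) :
    μ.real {ω | ∃ S : Finset V, Fintype.card V < l * S.card ∧ ω ∈ E S} ≤
      2 * (Real.exp 1 * l * Real.exp (-w)) := by
  set y := Real.exp 1 * l * Real.exp (-w) with hy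
  have hy0 : 0 ≤ y := by positivity
  rcases lt_or_ge (1 / 2) y with hy1 | hy1
  · exact measureReal_le_one.trans (by linarith)
  let f : ℕ → ℝ := fun k => if Fintype.card V < l * k then Real.exp (-w) ^ k else 0
  have hchoose (k : ℕ) (hk : 1 ≤ k) : ((Fintype.card V).choose k : ℝ) * f k ≤ y ^ k := by
    simp only [f]
    split_ifs with hkl
    · rw [hy, mul_pow]
      gcongr
      refine (choose_le_exp_mul_div_pow hk _).trans ?_
      gcongr
      exact (div_le_iff₀ (by exact_mod_cast hk)).2 hkl.le
    · rw [mul_zero]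
      positivity
  calc _ = μ.real (⋃ S ∈ Finset.univ.filter fun S : Finset V => Fintype.card V < l * S.card,
          E S) := by
        congr 1
        ext ω
        simp
    _ ≤ ∑ S : Finset V with Fintype.card V < l * S.card, μ.real (E S) :=
        measureReal_biUnion_finset_le _ _
    _ ≤ ∑ S : Finset V with Fintype.card V < l * S.card, f S.card := by
        refine Finset.sum_le_sum fun S hS => ?_
        have hS' := (Finset.mem_filter.1 hS).2
        refine (hE S hS').trans_eq ?_
        simp only [f]
        rw [if_pos hS', ← Real.exp_nat_mul, mul_neg, mul_comm]
    _ ≤ ∑ S : Finset V with S.Nonempty, f S.card := by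
        refine Finset.sum_le_sum_of_subset_of_nonneg (Finset.monotone_filter_right _
          fun S _ hS => ?_) fun S _ _ => by simp only [f]; positivity
        rw [Finset.nonempty_iff_ne_empty]
        rintro rfl
        simp only [Finset.card_empty, Nat.cast_zero, mul_zero] at hS
        exact absurd hS (Nat.cast_nonneg _).not_gt
    _ ≤ 2 * y := sum_nonempty_card_le hy0 hy1 hchoose

theorem measureReal_exists_perm_le [DecidableEq V] {E : Equiv.Perm V → Set Ω} {w : ℝ}
    (hE : ∀ τ ≠ 1, μ.real (E τ) ≤
      Real.exp (-((Real.log (Fintype.card V) + w) * τ.support.card))) :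
    μ.real {ω | ∃ τ ≠ 1, ω ∈ E τ} ≤ 2 * Real.exp (-w) := by
  rcases lt_or_ge (1 / 2) (Real.exp (-w)) with hw | hw
  · linarith [measureReal_le_one (μ := μ) (s := {ω | ∃ τ ≠ 1, ω ∈ E τ})]
  set x := Real.exp (-(Real.log (Fintype.card V) + w)) with hx
  have hx' : Fintype.card V * x ≤ Real.exp (-w) := by
    rcases (Fintype.card V).eq_zero_or_pos with h0 | hpos
    · simp [h0, (Real.exp_pos _).le]
    · have hpos' : (0 : ℝ) < Fintype.card V := by exact_mod_cast hpos
      rw [hx, neg_add, Real.exp_add, Real.exp_neg (Real.log _), Real.exp_log hpos',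
        mul_inv_cancel_left₀ hpos'.ne']
  calc μ.real {ω | ∃ τ ≠ 1, ω ∈ E τ} = μ.real (⋃ τ ∈ Finset.univ.filter (· ≠ 1), E τ) := by
        congr 1
        ext ω
        simp
    _ ≤ ∑ τ with τ ≠ 1, μ.real (E τ) := measureReal_biUnion_finset_le _ _
    _ ≤ ∑ τ : Equiv.Perm V with τ ≠ 1, x ^ τ.support.card := by
        refine Finset.sum_le_sum fun τ hτ => (hE τ (Finset.mem_filter.1 hτ).2).trans_eq ?_
        rw [hx, ← Real.exp_nat_mul]
        congr 1
        ring
    _ ≤ 2 * (Fintype.card V * x) := sum_ne_one_pow_card_support_le (Real.exp_pos _).le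
        (hx'.trans hw)
    _ ≤ 2 * Real.exp (-w) := by gcongr

end UnionBounds

/-! ## Confusable configurations are unlikely -/

section ConfusableBounds

variable {V : Type*} [Fintype V] [DecidableEq V]

theorem measureReal_exists_overlap_le (p s : I) {Q : Set (Equiv.Perm V)} {m w : ℝ}
    (hm : ∀ τ ∈ Q, τ.support.card * m ≤ (pairPerm τ).support.card)
    (h : Real.log (Fintype.card V) + w ≤ separationRate p s * m) :
    (configLaw (Pairs V) p s).real
        {x | ∃ τ ≠ 1, τ ∈ Q ∧ overlap 1 x ≤ overlap (pairPerm τ) x} ≤ 2 * Real.exp (-w) := by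
  refine measureReal_exists_perm_le (E := fun τ => {x | τ ∈ Q ∧ _}) fun τ _ => ?_
  by_cases hτ : τ ∈ Q
  · simp only [hτ, true_and]
    refine (measureReal_overlap_one_le_overlap_le (pairPerm τ) p s).trans ?_
    refine Real.exp_le_exp.2 (neg_le_neg ?_)
    calc _ ≤ separationRate p s * m * τ.support.card := by gcongr
      _ = separationRate p s * (τ.support.card * m) := by ring
      _ ≤ _ := mul_le_mul_of_nonneg_left (hm τ hτ) (separationRate_nonneg p s)
  · simp [hτ, (Real.exp_pos _).le]

theorem measureReal_confusable_le_of_dense (p s : I) (hN : 6 ≤ Fintype.card V)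
    (h : 8 * Real.log (Fintype.card V) ≤ Fintype.card V * separationRate p s) :
    (configLaw (Pairs V) p s).real {x | Confusable x} ≤
      2 * Real.exp (-Real.log (Fintype.card V)) := by
  have hN' : (6 : ℝ) ≤ Fintype.card V := by exact_mod_cast hN
  have hm (τ : Equiv.Perm V) : τ.support.card * (Fintype.card V / 4 : ℝ) ≤
      (pairPerm τ).support.card := by
    have hmul := mul_le_mul_of_nonneg_left (by linarith : (Fintype.card V / 2 : ℝ) ≤
      Fintype.card V - 3) τ.support.card.cast_nonneg
    linarith [card_support_mul_le_two_mul_card_support_pairPerm τ]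
  simpa [Confusable] using measureReal_exists_overlap_le p s (Q := Set.univ) (fun τ _ => hm τ)
    (w := Real.log (Fintype.card V)) (by linarith)

theorem overlap_eq_movedOverlap_add {F : Type*} [Fintype F] [DecidableEq F] (τ : Equiv.Perm F)
    (w : F → Bool × Bool) :
    overlap τ w = movedOverlap τ w + (τ.supportᶜ.filter fun e => (w e).1 ∧ (w e).2).card := by
  rw [overlap, movedOverlap, ← Finset.union_compl τ.support, Finset.filter_union,
    Finset.card_union_of_disjoint (Finset.disjoint_filter_filter disjoint_compl_right)]
  congr 2
  refine Finset.filter_congr fun e he => ?_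
  rw [Finset.mem_compl, Equiv.Perm.notMem_support] at he
  rw [he]

theorem overlap_one_eq_card_add {F : Type*} [Fintype F] [DecidableEq F] (τ : Equiv.Perm F)
    (w : F → Bool × Bool) :
    overlap 1 w = (τ.support.filter fun e => (w e).1 ∧ (w e).2).card +
      (τ.supportᶜ.filter fun e => (w e).1 ∧ (w e).2).card := by
  rw [overlap, ← Finset.union_compl τ.support, Finset.filter_union,
    Finset.card_union_of_disjoint (Finset.disjoint_filter_filter disjoint_compl_right)]
  rfl

-- The pairs fixed by `τ` contribute equally to the two overlaps, so only common edges incident to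
-- the support of `τ` matter, and a confusing `τ` must compensate for losing them.
theorem Confusable.cases {x : Pairs V → Bool × Bool} (h : Confusable x) (l t : ℝ) :
    (∃ τ : Equiv.Perm V, τ ≠ 1 ∧ l * τ.support.card ≤ Fintype.card V ∧
      overlap 1 x ≤ overlap (pairPerm τ) x) ∨
    (∃ S : Finset V, Fintype.card V < l * S.card ∧
      (((incidentPairs S).filter fun e => (x e).1 ∧ (x e).2).card : ℝ) ≤ S.card * (t + 1)) ∨
    ∃ τ : Equiv.Perm V, τ ≠ 1 ∧ τ.support.card * t ≤ movedOverlap (pairPerm τ) x := by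
  obtain ⟨τ, hτ, hle⟩ := h
  rcases le_or_gt (l * τ.support.card) (Fintype.card V) with hsmall | hlarge
  · exact Or.inl ⟨τ, hτ, hsmall, hle⟩
  rcases le_or_gt (((incidentPairs τ.support).filter fun e => (x e).1 ∧ (x e).2).card : ℝ)
    (τ.support.card * (t + 1)) with hfew | hmany
  · exact Or.inr (Or.inl ⟨τ.support, hlarge, hfew⟩)
  · refine Or.inr (Or.inr ⟨τ, hτ, ?_⟩)
    rw [overlap_one_eq_card_add (pairPerm τ), overlap_eq_movedOverlap_add,
      add_le_add_iff_right] at hle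
    have hcommon : (((incidentPairs τ.support).filter fun e => (x e).1 ∧ (x e).2).card : ℝ) ≤
        movedOverlap (pairPerm τ) x + τ.support.card := by
      exact_mod_cast (card_filter_incidentPairs_le τ _).trans (Nat.add_le_add_right hle _)
    linarith

theorem measureReal_exists_few_common_le (p s : I) {l : ℝ} (hl : 0 ≤ l)
    (hN : 3 ≤ Fintype.card V) (h : l ≤ Fintype.card V * (p * s ^ 2)) :
    (configLaw (Pairs V) p s).real {x | ∃ S : Finset V, Fintype.card V < l * S.card ∧
        (((incidentPairs S).filter fun e => (x e).1 ∧ (x e).2).card : ℝ) ≤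
          S.card * (l / 20 + 1)} ≤ 2 * (Real.exp 1 * l * Real.exp (-(l / 10 - 1))) := by
  have hN' : (3 : ℝ) ≤ Fintype.card V := by exact_mod_cast hN
  have hps : (0 : ℝ) ≤ p * s ^ 2 := mul_nonneg p.2.1 (sq_nonneg _)
  refine measureReal_exists_large_finset_le (E := fun S : Finset V => {x | _}) hl fun S _ =>
    (measureReal_card_common_le (incidentPairs S) p s _).trans (Real.exp_le_exp.2 ?_)
  have hlN : l * (3 / 5) ≤ p * s ^ 2 * (Fintype.card V - 1) := by
    have := mul_le_mul_of_nonneg_left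
      (by linarith : (Fintype.card V * (3 / 5) : ℝ) ≤ Fintype.card V - 1) hps
    linarith
  have hcard := mul_le_mul_of_nonneg_left hlN (Nat.cast_nonneg (α := ℝ) S.card)
  have hpairs := mul_le_mul_of_nonneg_left (card_mul_le_two_mul_card_incidentPairs S) hps
  linarith

theorem measureReal_exists_movedOverlap_le (p s : I)
    (h : 2 * (p * Real.exp 60) ^ 2 * Fintype.card V ≤ Real.log (Fintype.card V)) :
    (configLaw (Pairs V) p s).real {x | ∃ τ : Equiv.Perm V, τ ≠ 1 ∧
        τ.support.card * (Real.log (Fintype.card V) / 20) ≤ movedOverlap (pairPerm τ) x} ≤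
      2 * Real.exp (-Real.log (Fintype.card V)) := by
  refine measureReal_exists_perm_le (E := fun τ : Equiv.Perm V => {x | _}) fun τ _ =>
    (measureReal_le_movedOverlap_le (pairPerm τ) p s (c := 60) (by norm_num) _).trans
      (Real.exp_le_exp.2 ?_)
  have hmoved : ((pairPerm τ).support.card : ℝ) ≤ τ.support.card * Fintype.card V := by
    exact_mod_cast card_support_pairPerm_le τ
  have hle := mul_le_mul_of_nonneg_left hmoved
    (by positivity : 0 ≤ 2 * ((p : ℝ) * Real.exp 60) ^ 2)
  have hlog := mul_le_mul_of_nonneg_left h (Nat.cast_nonneg (α := ℝ) τ.support.card)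
  linarith

theorem measureReal_confusable_le_of_sparse (p s : I) {w : ℝ} (hN : 3 ≤ Fintype.card V)
    (hrate : Real.log (Fintype.card V) + w ≤
      separationRate p s * (Fintype.card V - Fintype.card V / Real.log (Fintype.card V)))
    (hps : Real.log (Fintype.card V) ≤ Fintype.card V * (p * s ^ 2))
    (hp : 2 * (p * Real.exp 60) ^ 2 * Fintype.card V ≤ Real.log (Fintype.card V)) :
    (configLaw (Pairs V) p s).real {x | Confusable x} ≤ 2 * Real.exp (-w) +
      (2 * (Real.exp 1 * Real.log (Fintype.card V) *
        Real.exp (-(Real.log (Fintype.card V) / 10 - 1))) +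
        2 * Real.exp (-Real.log (Fintype.card V))) := by
  have hl : 0 < Real.log (Fintype.card V) := Real.log_pos (by exact_mod_cast (by omega))
  set l := Real.log (Fintype.card V)
  have hsmall (τ : Equiv.Perm V) (hτ : l * τ.support.card ≤ Fintype.card V) :
      τ.support.card * (Fintype.card V - Fintype.card V / l) ≤ ((pairPerm τ).support.card : ℝ) := by
    refine le_trans ?_ (card_support_mul_sub_le_card_support_pairPerm τ)
    gcongr
    rwa [le_div_iff₀' hl]
  refine (measureReal_mono fun x hx => Confusable.cases hx.out l (l / 20)).trans ?_
  refine (measureReal_union_le _ _).trans (add_le_add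
    (measureReal_exists_overlap_le p s (Q := {τ | l * τ.support.card ≤ _}) hsmall hrate) ?_)
  exact (measureReal_union_le _ _).trans (add_le_add
    (measureReal_exists_few_common_le p s hl.le hN hps)
    (measureReal_exists_movedOverlap_le p s hp))

end ConfusableBounds

/-! ## Asymptotics -/

theorem separationRate_le (p s : I) : separationRate p s ≤ p * s ^ 2 := by
  have hp := p.2.1
  have hps : 0 ≤ (p : ℝ) * s := mul_nonneg p.2.1 s.2.1
  have _ : (p : ℝ) * s ≤ 1 := mul_le_one₀ p.2.2 s.2.1 s.2.2
  rw [separationRate, mul_assoc]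
  refine mul_le_of_le_one_right (by positivity) (mul_le_one₀ (by linarith) (sq_nonneg _) ?_)
  exact pow_le_one₀ (sub_nonneg.2 (Real.sqrt_le_one.2 p.2.2)) (by linarith [Real.sqrt_nonneg p])

theorem mul_one_sub_three_sqrt_le_separationRate (p s : I) :
    p * s ^ 2 * (1 - 3 * √p) ≤ separationRate p s := by
  have hz0 : 0 ≤ √(p : ℝ) := Real.sqrt_nonneg p
  have hz1 : √(p : ℝ) ≤ 1 := Real.sqrt_le_one.2 p.2.2
  have hps : (p : ℝ) * s ≤ √p :=
    calc (p : ℝ) * s ≤ p := mul_le_of_le_one_right p.2.1 s.2.2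
      _ = √p * √p := (Real.mul_self_sqrt p.2.1).symm
      _ ≤ √p := mul_le_of_le_one_right hz0 hz1
  rw [separationRate, mul_assoc _ (1 - _ : ℝ)]
  refine mul_le_mul_of_nonneg_left ?_ (mul_nonneg p.2.1 (sq_nonneg _))
  calc 1 - 3 * √(p : ℝ) ≤ (1 - √p) * (1 - √p) ^ 2 := by
        linarith [mul_nonneg (sq_nonneg √(p : ℝ)) (by linarith : 0 ≤ 3 - √(p : ℝ))]
    _ ≤ (1 - p * s) * (1 - √p) ^ 2 := by gcongr

theorem mul_le_separationRate {p₁ : ℝ} (p s : I) (hp : (p : ℝ) ≤ p₁) (hp₁ : p₁ < 1) :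
    p * s ^ 2 * ((1 - p₁) * (1 - √p₁) ^ 2) ≤ separationRate p s := by
  have hz₁ : √p₁ ≤ 1 := Real.sqrt_le_one.2 hp₁.le
  have hps : (p : ℝ) * s ≤ p₁ := (mul_le_of_le_one_right p.2.1 s.2.2).trans hp
  rw [separationRate, mul_assoc _ (1 - _ : ℝ)]
  refine mul_le_mul_of_nonneg_left ?_ (mul_nonneg p.2.1 (sq_nonneg _))
  gcongr
  exact sub_nonneg.2 (hps.trans hp₁.le)

theorem sub_sub_le_separationRate_mul {N c l : ℝ} (p s : I) (hN : 0 ≤ N) (hl : 0 < l)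
    (hsqrt : 3 * (N * (p * s ^ 2)) * √p ≤ 1) (hc : N * (p * s ^ 2) ≤ c * l) :
    N * (p * s ^ 2) - 1 - c ≤ separationRate p s * (N - N / l) := by
  have hlower := mul_le_mul_of_nonneg_left (mul_one_sub_three_sqrt_le_separationRate p s) hN
  have hupper : N * separationRate p s / l ≤ c := by
    rw [div_le_iff₀ hl]
    exact (mul_le_mul_of_nonneg_left (separationRate_le p s) hN).trans hc
  calc N * (p * s ^ 2) - 1 - c ≤ N * separationRate p s - N * separationRate p s / l := by
        linarith
    _ = separationRate p s * (N - N / l) := by ring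

theorem tendsto_log_natCast_pow_div (k : ℕ) :
    Tendsto (fun n : ℕ => Real.log n ^ k / (n : ℝ)) atTop (𝓝 0) :=
  (Real.isLittleO_pow_log_id_atTop (n := k)).tendsto_div_nhds_zero.comp tendsto_natCast_atTop_atTop

theorem eventually_mul_log_mul_sqrt_le_one (K c : ℝ) :
    ∀ᶠ n : ℕ in atTop, ∀ p : ℝ, 0 ≤ p → n * p ≤ K * Real.log n → c * Real.log n * √p ≤ 1 := by
  have hlim := (tendsto_log_natCast_pow_div 3).const_mul (c ^ 2 * K)
  rw [mul_zero] at hlim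
  filter_upwards [hlim.eventually_le_const one_pos, eventually_gt_atTop 0] with n hn hn0 p hp0 hp
  have hn0' : (0 : ℝ) < n := by exact_mod_cast hn0
  rw [← le_div_iff₀' hn0'] at hp
  refine (le_abs_self _).trans ((sq_le_one_iff_abs_le_one _).1 ?_)
  calc (c * Real.log n * √p) ^ 2 = (c * Real.log n) ^ 2 * p := by rw [mul_pow, Real.sq_sqrt hp0]
    _ ≤ (c * Real.log n) ^ 2 * (K * Real.log n / n) := by gcongr
    _ = c ^ 2 * K * (Real.log n ^ 3 / n) := by ring
    _ ≤ 1 := hn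

theorem eventually_mul_sq_mul_natCast_le_log (K c : ℝ) :
    ∀ᶠ n : ℕ in atTop, ∀ p : ℝ, 0 ≤ p → n * p ≤ K * Real.log n →
      2 * (p * c) ^ 2 * n ≤ Real.log n := by
  have hlim := (tendsto_log_natCast_pow_div 1).const_mul (2 * (K * c) ^ 2)
  rw [mul_zero] at hlim
  filter_upwards [hlim.eventually_le_const one_pos, eventually_gt_atTop 0] with n hn hn0 p hp0 hp
  have _ : (0 : ℝ) < n := by exact_mod_cast hn0
  calc 2 * (p * c) ^ 2 * n = 2 * c ^ 2 * (n * p) ^ 2 / n := by field_simp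
    _ ≤ 2 * c ^ 2 * (K * Real.log n) ^ 2 / n := by gcongr
    _ = 2 * (K * c) ^ 2 * (Real.log n ^ 1 / n) * Real.log n := by ring
    _ ≤ Real.log n := mul_le_of_le_one_left (Real.log_natCast_nonneg n) hn

theorem tendsto_log_natCast_atTop : Tendsto (fun n : ℕ => Real.log n) atTop atTop :=
  Real.tendsto_log_atTop.comp tendsto_natCast_atTop_atTop

theorem tendsto_log_mul_exp_neg_log_div :
    Tendsto (fun n : ℕ => Real.exp 1 * Real.log n * Real.exp (-(Real.log n / 10 - 1)))
      atTop (𝓝 0) := by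
  have hlim := ((Real.tendsto_pow_mul_exp_neg_atTop_nhds_zero 1).comp
    (tendsto_log_natCast_atTop.atTop_div_const (by norm_num : (0 : ℝ) < 10))).const_mul
    (Real.exp 1 * Real.exp 1 * 10)
  rw [mul_zero] at hlim
  refine hlim.congr fun n => ?_
  rw [Function.comp_apply, neg_sub, sub_eq_add_neg, Real.exp_add]
  ring

/-- An upper bound for the probability of a confusable configuration on `n` vertices, where `w` is
the excess of the mean degree of the intersection graph over the connectivity threshold. -/
noncomputable def confusableBound (n : ℕ) (w : ℝ) : ℝ :=
  2 * Real.exp (-w) + (2 * (Real.exp 1 * Real.log n * Real.exp (-(Real.log n / 10 - 1))) +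
    2 * Real.exp (-Real.log n))

theorem tendsto_confusableBound {w : ℕ → ℝ} (hw : Tendsto w atTop atTop) :
    Tendsto (fun n => confusableBound n (w n)) atTop (𝓝 0) := by
  simpa [confusableBound] using ((Real.tendsto_exp_neg_atTop_nhds_zero.comp hw).const_mul 2).add
    ((tendsto_log_mul_exp_neg_log_div.const_mul 2).add
      ((Real.tendsto_exp_neg_atTop_nhds_zero.comp tendsto_log_natCast_atTop).const_mul 2))

theorem measureReal_confusable_le_confusableBound_of_dense {n : ℕ} (p s : I) {p₁ c : ℝ}
    (w : ℝ) (hn : 6 ≤ n) (hp : (p : ℝ) ≤ p₁) (hp₁ : p₁ < 1)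
    (hc : c * ((1 - p₁) * (1 - √p₁) ^ 2) = 8)
    (hdense : c * Real.log n ≤ n * (p * s ^ 2 : ℝ)) :
    (configLaw (Pairs (Fin n)) p s).real {x | Confusable x} ≤ confusableBound n w := by
  have hrate : 8 * Real.log n ≤ n * separationRate p s :=
    calc 8 * Real.log n = c * Real.log n * ((1 - p₁) * (1 - √p₁) ^ 2) := by rw [← hc]; ring
      _ ≤ n * (p * s ^ 2 : ℝ) * ((1 - p₁) * (1 - √p₁) ^ 2) := by gcongr
      _ ≤ n * separationRate p s := by
        rw [mul_assoc]
        exact mul_le_mul_of_nonneg_left (mul_le_separationRate p s hp hp₁) n.cast_nonneg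
  have hle := measureReal_confusable_le_of_dense (V := Fin n) p s
    (by simpa using hn) (by simpa using hrate)
  rw [Fintype.card_fin] at hle
  rw [confusableBound, ← add_assoc]
  have _ := Real.log_natCast_nonneg n
  exact hle.trans (le_add_of_nonneg_left (by positivity))

theorem measureReal_confusable_le_confusableBound_of_sparse {n : ℕ} (p s : I) {c : ℝ}
    (hn : 3 ≤ n) (hmean : Real.log n ≤ n * (p * s ^ 2 : ℝ))
    (hsparse : n * (p * s ^ 2 : ℝ) ≤ c * Real.log n) (hsqrt : 3 * c * Real.log n * √(p : ℝ) ≤ 1)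
    (hp : 2 * ((p : ℝ) * Real.exp 60) ^ 2 * n ≤ Real.log n) :
    (configLaw (Pairs (Fin n)) p s).real {x | Confusable x} ≤
      confusableBound n (n * (p * s ^ 2 : ℝ) - Real.log n - c - 1) := by
  have hlog : 0 < Real.log n := Real.log_pos (by exact_mod_cast (by omega))
  have hsqrt' : 3 * (n * (p * s ^ 2 : ℝ)) * √(p : ℝ) ≤ 1 := by
    rw [mul_assoc 3 c] at hsqrt
    exact le_trans (by gcongr) hsqrt
  have hle := measureReal_confusable_le_of_sparse (V := Fin n) p s
    (w := n * (p * s ^ 2 : ℝ) - Real.log n - c - 1)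
  simp only [Fintype.card_fin] at hle
  refine hle hn ?_ hmean hp
  linarith [sub_sub_le_separationRate_mul p s n.cast_nonneg hlog hsqrt' hsparse]

-- The constant `c` separates the dense regime `c * log n ≤ n * p * s ^ 2`, where a crude count of
-- the permutations is enough, from the sparse one, where `p` is of order `log n / n`.
theorem eventually_measureReal_confusable_le {s₀ p₁ c : ℝ} (hs₀ : 0 < s₀) (hp₁ : p₁ < 1)
    (hc : c * ((1 - p₁) * (1 - √p₁) ^ 2) = 8) :
    ∀ᶠ n : ℕ in atTop, ∀ p s : I, s₀ ≤ s → (p : ℝ) ≤ p₁ → Real.log n ≤ n * (p * s ^ 2 : ℝ) →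
      (configLaw (Pairs (Fin n)) p s).real {x | Confusable x} ≤
        confusableBound n (n * (p * s ^ 2 : ℝ) - Real.log n - c - 1) := by
  filter_upwards [eventually_ge_atTop 6, eventually_mul_log_mul_sqrt_le_one (c / s₀ ^ 2) (3 * c),
    eventually_mul_sq_mul_natCast_le_log (c / s₀ ^ 2) (Real.exp 60)]
    with n hn hsqrt hmoved p s hs hp hmean
  rcases le_or_gt (c * Real.log n) (n * (p * s ^ 2 : ℝ)) with hdense | hsparse
  · exact measureReal_confusable_le_confusableBound_of_dense p s _ hn hp hp₁ hc hdense
  · have hnp : n * (p : ℝ) ≤ c / s₀ ^ 2 * Real.log n := by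
      rw [div_mul_eq_mul_div, le_div_iff₀ (by positivity), mul_assoc]
      refine le_trans ?_ hsparse.le
      gcongr
      exact p.2.1
    exact measureReal_confusable_le_confusableBound_of_sparse p s (by omega) hmean hsparse.le
      (hsqrt p p.2.1 hnp) (hmoved p p.2.1 hnp)

theorem tendsto_configLaw_confusable {p s : ℕ → I}
    (hs : ∃ s₀ : ℝ, 0 < s₀ ∧ ∀ᶠ n in atTop, s₀ ≤ (s n : ℝ))
    (hp : ∃ p₁ : ℝ, p₁ < 1 ∧ ∀ᶠ n in atTop, (p n : ℝ) ≤ p₁)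
    (h : Tendsto (fun n : ℕ => (n : ℝ) * p n * (s n : ℝ) ^ 2 - Real.log n) atTop atTop) :
    Tendsto (fun n => configLaw (Pairs (Fin n)) (p n) (s n) {w | Confusable w}) atTop (𝓝 0) := by
  obtain ⟨s₀, hs₀, hs⟩ := hs
  obtain ⟨p₁, hp₁, hp⟩ := hp
  have hz₁ : √p₁ < 1 := by rwa [Real.sqrt_lt' one_pos, one_pow]
  have hgap : 0 < (1 - p₁) * (1 - √p₁) ^ 2 :=
    mul_pos (sub_pos.2 hp₁) (pow_pos (sub_pos.2 hz₁) 2)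
  have hbound := ENNReal.tendsto_ofReal (tendsto_confusableBound (tendsto_atTop_add_const_right _
    (-(8 / ((1 - p₁) * (1 - √p₁) ^ 2)) - 1) h))
  rw [ENNReal.ofReal_zero] at hbound
  refine tendsto_of_tendsto_of_tendsto_of_le_of_le' tendsto_const_nhds hbound
    (Eventually.of_forall fun n => zero_le) ?_
  filter_upwards [hs, hp, h.eventually_ge_atTop 0,
    eventually_measureReal_confusable_le hs₀ hp₁ (div_mul_cancel₀ 8 hgap.ne')]
    with n hsn hpn hmean hle
  rw [← ofReal_measureReal]
  refine ENNReal.ofReal_le_ofReal ((hle _ _ hsn hpn ?_).trans_eq ?_)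
  · linarith
  · ring_nf

theorem tendsto_toOuterMeasure_randomSubset {α : ℕ → I}
    (hα : Tendsto (fun n : ℕ => (α n : ℝ) * n) atTop atTop) :
    Tendsto (fun n : ℕ => (randomSubset n (α n)).toOuterMeasure
        {S | (n : ℝ) ^ (3 * ((α n : ℝ) * n)) < (n : ℝ) ^ S.ncard}) atTop (𝓝 0) := by
  have hbound := ENNReal.tendsto_ofReal (Real.tendsto_exp_neg_atTop_nhds_zero.comp hα)
  rw [ENNReal.ofReal_zero] at hbound
  refine tendsto_of_tendsto_of_tendsto_of_le_of_le' tendsto_const_nhds hbound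
    (Eventually.of_forall fun n => zero_le) ?_
  filter_upwards [eventually_ge_atTop 1] with n hn
  exact toOuterMeasure_randomSubset_rpow_lt_pow_ncard_le hn (α n)

end GraphMatching

theorem theorem5 :
    ∃ C : ℝ, 0 < C ∧
      ∀ (p s α : ℕ → unitInterval) (A : ∀ n, GraphMatching.SeededAlg n)
        (tie : ∀ n, SimpleGraph (Fin n) → SimpleGraph (Fin n) →
          Finset (Equiv.Perm (Fin n)) → Equiv.Perm (Fin n)),
        (∀ n G₁ G₂ S, S.Nonempty → tie n G₁ G₂ S ∈ S) →
        (∃ s₀ : ℝ, 0 < s₀ ∧ ∀ᶠ n in atTop, s₀ ≤ (s n : ℝ)) →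
        (∃ p₁ : ℝ, p₁ < 1 ∧ ∀ᶠ n in atTop, (p n : ℝ) ≤ p₁) →
        Tendsto (fun n : ℕ => (n : ℝ) * p n * (s n : ℝ) ^ 2 - Real.log n) atTop atTop →
        Tendsto (fun n : ℕ => (α n : ℝ) * n) atTop atTop →
        Tendsto (fun n => GraphMatching.seededSuccess n (p n) (s n) (α n) (A n)) atTop (𝓝 1) →
        Tendsto (fun n =>
          (GraphMatching.seedlessRun n (p n) (s n) (α n) (A n) (tie n)).toOuterMeasure
            {y | y.1 = y.2.2 ∧ (y.2.1 : ℝ) ≤ (n : ℝ) ^ (C * ((α n : ℝ) * n))})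
          atTop (𝓝 1) := by
  refine ⟨3, three_pos, fun p s α A tie htie hs hp h hα hA => ?_⟩
  have herror := (GraphMatching.tendsto_configLaw_confusable hs hp h).add
    (GraphMatching.tendsto_toOuterMeasure_randomSubset hα)
  have hlower := ENNReal.Tendsto.sub hA herror (Or.inl ENNReal.one_ne_top)
  rw [add_zero, tsub_zero] at hlower
  refine tendsto_of_tendsto_of_tendsto_of_le_of_le hlower tendsto_const_nhds
    (fun n => tsub_le_iff_right.2 ?_) fun n => ?_
  · refine (GraphMatching.seededSuccess_le (p n) (s n) (α n) (A n) (htie n)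
      ((n : ℝ) ^ (3 * ((α n : ℝ) * n)))).trans ?_
    rw [add_assoc]
    gcongr
    exact GraphMatching.correlatedER_notUniqueMin_le (p n) (s n)
  · exact (MeasureTheory.measure_mono (Set.subset_univ _)).trans_eq
      ((PMF.toOuterMeasure_apply_eq_one_iff _ _).2 (Set.subset_univ _))
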